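/- An \emph{information graph} $G=(V,E,\alpha)$ is a finite connected simple undirected graph together with a sampling probability $\alpha\in(0,1]$. The \emph{proximity} of $u,v\in V$ is the probability that $u$ and $v$ are connected after every edge of $G$ is deleted independently with probability $1-\alpha$; the \emph{broadcast} of $G$ is the minimum proximity over all pairs of vertices. Given $G$ on $n$ vertices and an integer $k\ge 0$, let $\beta^*$ be the maximum broadcast of $G+F=(V,E\cup F,\alpha)$ over all sets $F$ of at most $k$ non-edges of $G$. Algorithms are programs of a random access machine (unit-cost addition, subtraction, comparison and memory access) equipped with an oracle that returns the exact proximity of any two given vertices in any given graph on $V$ with sampling probability $\alpha$; they receive $G$, $k$, $\alpha$, $\varepsilon$ as input. There is an absolute constant $C$ such that for all $\varepsilon>0$ and $\alpha\in(0,1]$ the following two algorithms exist, each running in time polynomial in the input size (the number $n$ of vertices plus the binary length of $k$), where the polynomial may depend on $\varepsilon$ and $\alpha$. (i) For every information graph $G$ on $n$ vertices with sampling probability $\alpha$ and every $k\ge 1$, the first algorithm outputs a set $F$ of at most $C k^3\log_2 n$ non-edges of $G$ such that the broadcast of $G+F$ is at least $$\frac{4\beta^*}{(1+\varepsilon)(12k^4+3k^2)}.$$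 (ii) For every information graph $G$ on $n$ vertices with sampling probability $\alpha$ and every $k\ge 0$, the second algorithm outputs a set $F$ of at most $C k^2\log_2 n$ non-edges of $G$ such that the broadcast of $G+F$ is at least $$\frac{\beta^*\alpha}{(1+\varepsilon)(12k^2+3)}.$$ -/

import Mathlib

/-! ### Information graphs: proximity, broadcast, optimum broadcast -/

section InformationGraphs

open Classical in
/-- The proximity of `u` and `v`: the probability that `u` and `v` are connected in the random
graph in which every edge of `G` is kept, independently, with probability `α` (and deleted with
probability `1 - α`). The sum runs over the possible sets `S` of surviving edges. -/
noncomputable def proximity {V : Type*} [Fintype V] (G : SimpleGraph V) (α : ℝ) (u v : V) : ℝ :=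
  ∑ S ∈ G.edgeFinset.powerset,
    if (SimpleGraph.fromEdgeSet (S : Set (Sym2 V))).Reachable u v then
      α ^ S.card * (1 - α) ^ (G.edgeFinset \ S).card
    else 0

/-- The broadcast of `G`: the minimum proximity over all pairs of vertices (a vertex has
proximity `1` to itself). -/
noncomputable def broadcast {V : Type*} [Fintype V] (G : SimpleGraph V) (α : ℝ) : ℝ :=
  ⨅ p : V × V, proximity G α p.1 p.2

/-- The augmented graph `G + F`. -/
def addEdges {V : Type*} (G : SimpleGraph V) (F : Finset (Sym2 V)) : SimpleGraph V :=
  G ⊔ SimpleGraph.fromEdgeSet (F : Set (Sym2 V))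

/-- `F` consists of edges that can be added to `G`: pairs of distinct, non-adjacent vertices. -/
def IsAugmentation {V : Type*} (G : SimpleGraph V) (F : Finset (Sym2 V)) : Prop :=
  (F : Set (Sym2 V)) ⊆ Gᶜ.edgeSet

/-- The optimum `β*` of Broadcast Improvement on `(G, α)` with budget `k`. (Adding edges never
lowers the broadcast, so "at most `k`" and "exactly `k`" agree whenever `k` edges are missing.) -/
noncomputable def optBroadcast {V : Type*} [Fintype V] (G : SimpleGraph V) (α : ℝ) (k : ℕ) : ℝ :=
  sSup {b : ℝ | ∃ F : Finset (Sym2 V),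
    IsAugmentation G F ∧ F.card ≤ k ∧ b = broadcast (addEdges G F) α}

end InformationGraphs

/-! ### The machine model

Structured programs for a random access machine with natural-number and real registers and
doubly indexed memories. The only arithmetic is addition, subtraction and comparison, so that
unit cost is polynomially equivalent to bit cost on the natural-number part; there are no real
constants other than natural numbers. A program may consult an oracle. -/

namespace OracleMachine

/-- A memory configuration. Registers are numbered, and so are the (infinite) two-dimensional
arrays: `natArr a i j` is the entry `(i, j)` of the `a`-th array. -/
structure Store where
  natReg : ℕ → ℕ
  natArr : ℕ → ℕ → ℕ → ℕ
  realReg : ℕ → ℝ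
  realArr : ℕ → ℕ → ℕ → ℝ

/-- Expressions with a natural-number value. -/
inductive NatExpr where
  | const (c : ℕ)
  | reg (x : ℕ)
  | arr (a : ℕ) (i j : NatExpr)
  | add (e f : NatExpr)
  | sub (e f : NatExpr)

/-- Expressions with a real value. -/
inductive RealExpr where
  | ofNat (e : NatExpr)
  | reg (x : ℕ)
  | arr (a : ℕ) (i j : NatExpr)
  | add (e f : RealExpr)
  | sub (e f : RealExpr)

/-- Boolean tests. -/
inductive Test where
  | natLt (e f : NatExpr)
  | realLt (e f : RealExpr)
  | not (b : Test)
  | and (b c : Test)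

/-- Programs. `query x a i j` writes to real register `x` the answer of the oracle on the
content of the `a`-th natural-number array and on the values of `i` and `j`. -/
inductive Program where
  | skip
  | setNat (x : ℕ) (e : NatExpr)
  | setReal (x : ℕ) (e : RealExpr)
  | storeNat (a : ℕ) (i j e : NatExpr)
  | storeReal (a : ℕ) (i j : NatExpr) (e : RealExpr)
  | query (x a : ℕ) (i j : NatExpr)
  | seq (P Q : Program)
  | ite (b : Test) (P Q : Program)
  | loop (b : Test) (P : Program)

/-- Value of a natural-number expression (subtraction is truncated at `0`). -/
def NatExpr.eval (σ : Store) : NatExpr → ℕ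
  | const c => c
  | reg x => σ.natReg x
  | arr a i j => σ.natArr a (i.eval σ) (j.eval σ)
  | add e f => e.eval σ + f.eval σ
  | sub e f => e.eval σ - f.eval σ

/-- Value of a real expression. -/
def RealExpr.eval (σ : Store) : RealExpr → ℝ
  | ofNat e => (e.eval σ : ℝ)
  | reg x => σ.realReg x
  | arr a i j => σ.realArr a (i.eval σ) (j.eval σ)
  | add e f => e.eval σ + f.eval σ
  | sub e f => e.eval σ - f.eval σ

/-- Truth of a test. -/
def Test.Holds (σ : Store) : Test → Prop
  | natLt e f => e.eval σ < f.eval σ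
  | realLt e f => e.eval σ < f.eval σ
  | not b => ¬ b.Holds σ
  | and b c => b.Holds σ ∧ c.Holds σ

/-- Number of steps for evaluating a natural-number expression: one per operation. -/
def NatExpr.cost : NatExpr → ℕ
  | const _ => 1
  | reg _ => 1
  | arr _ i j => 1 + i.cost + j.cost
  | add e f => 1 + e.cost + f.cost
  | sub e f => 1 + e.cost + f.cost

/-- Number of steps for evaluating a real expression. -/
def RealExpr.cost : RealExpr → ℕ
  | ofNat e => 1 + e.cost
  | reg _ => 1
  | arr _ i j => 1 + i.cost + j.cost
  | add e f => 1 + e.cost + f.cost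
  | sub e f => 1 + e.cost + f.cost

/-- Number of steps for evaluating a test. -/
def Test.cost : Test → ℕ
  | natLt e f => 1 + e.cost + f.cost
  | realLt e f => 1 + e.cost + f.cost
  | not b => 1 + b.cost
  | and b c => 1 + b.cost + c.cost

/-- Writing to a natural-number register. -/
def Store.setNatReg (σ : Store) (x v : ℕ) : Store :=
  { σ with natReg := Function.update σ.natReg x v }

/-- Writing to a real register. -/
noncomputable def Store.setRealReg (σ : Store) (x : ℕ) (v : ℝ) : Store :=
  { σ with realReg := Function.update σ.realReg x v }

/-- Writing to a natural-number array. -/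
def Store.setNatArr (σ : Store) (a i j v : ℕ) : Store :=
  { σ with natArr := fun a' i' j' =>
      if a' = a ∧ i' = i ∧ j' = j then v else σ.natArr a' i' j' }

/-- Writing to a real array. -/
noncomputable def Store.setRealArr (σ : Store) (a i j : ℕ) (v : ℝ) : Store :=
  { σ with realArr := fun a' i' j' =>
      if a' = a ∧ i' = i ∧ j' = j then v else σ.realArr a' i' j' }

/-- `Runs O P σ t τ`: with oracle `O`, the program `P` started in `σ` halts in `τ` after exactly
`t` steps. An oracle call costs one step (besides the evaluation of its operands). -/
inductive Runs (O : (ℕ → ℕ → ℕ) → ℕ → ℕ → ℝ) : Program → Store → ℕ → Store → Prop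
  | skip (σ : Store) : Runs O .skip σ 1 σ
  | setNat (x : ℕ) (e : NatExpr) (σ : Store) :
      Runs O (.setNat x e) σ (1 + e.cost) (σ.setNatReg x (e.eval σ))
  | setReal (x : ℕ) (e : RealExpr) (σ : Store) :
      Runs O (.setReal x e) σ (1 + e.cost) (σ.setRealReg x (e.eval σ))
  | storeNat (a : ℕ) (i j e : NatExpr) (σ : Store) :
      Runs O (.storeNat a i j e) σ (1 + i.cost + j.cost + e.cost)
        (σ.setNatArr a (i.eval σ) (j.eval σ) (e.eval σ))
  | storeReal (a : ℕ) (i j : NatExpr) (e : RealExpr) (σ : Store) :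
      Runs O (.storeReal a i j e) σ (1 + i.cost + j.cost + e.cost)
        (σ.setRealArr a (i.eval σ) (j.eval σ) (e.eval σ))
  | query (x a : ℕ) (i j : NatExpr) (σ : Store) :
      Runs O (.query x a i j) σ (1 + i.cost + j.cost)
        (σ.setRealReg x (O (σ.natArr a) (i.eval σ) (j.eval σ)))
  | seq (P Q : Program) (σ τ ρ : Store) (s t : ℕ)
      (hP : Runs O P σ s τ) (hQ : Runs O Q τ t ρ) : Runs O (.seq P Q) σ (s + t) ρ
  | iteTrue (b : Test) (P Q : Program) (σ τ : Store) (t : ℕ)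
      (hb : b.Holds σ) (hP : Runs O P σ t τ) : Runs O (.ite b P Q) σ (1 + b.cost + t) τ
  | iteFalse (b : Test) (P Q : Program) (σ τ : Store) (t : ℕ)
      (hb : ¬ b.Holds σ) (hQ : Runs O Q σ t τ) : Runs O (.ite b P Q) σ (1 + b.cost + t) τ
  | loopTrue (b : Test) (P : Program) (σ τ ρ : Store) (s t : ℕ)
      (hb : b.Holds σ) (hP : Runs O P σ s τ) (hL : Runs O (.loop b P) τ t ρ) :
      Runs O (.loop b P) σ (1 + b.cost + s + t) ρ
  | loopFalse (b : Test) (P : Program) (σ : Store)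
      (hb : ¬ b.Holds σ) : Runs O (.loop b P) σ (1 + b.cost) σ

end OracleMachine

/-! ### Algorithms for Broadcast Improvement -/

section Algorithms

open OracleMachine

/-- The proximity oracle for graphs on `Fin n` with sampling probability `α`: on a square array
`A` (the graph in which distinct `a`, `b` are adjacent iff `A a b ≠ 0` or `A b a ≠ 0`) and two
vertices, it returns their proximity. -/
noncomputable def proximityOracle (n : ℕ) (α : ℝ) (A : ℕ → ℕ → ℕ) (i j : ℕ) : ℝ :=
  if h : i < n ∧ j < n then
    proximity (SimpleGraph.fromRel fun a b : Fin n => A a b ≠ 0) α ⟨i, h.1⟩ ⟨j, h.2⟩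
  else 0

open Classical in
/-- The input: `n` and `k` in the natural-number registers `0` and `1`, `α` and `ε` in the real
registers `0` and `1`, the adjacency matrix of `G` in array `0`, and `0` everywhere else. -/
noncomputable def inputStore (n : ℕ) (G : SimpleGraph (Fin n)) (k : ℕ) (α ε : ℝ) : Store where
  natReg x := if x = 0 then n else if x = 1 then k else 0
  natArr a i j :=
    if a = 0 ∧ ∃ (hi : i < n) (hj : j < n), G.Adj ⟨i, hi⟩ ⟨j, hj⟩ then 1 else 0
  realReg x := if x = 0 then α else if x = 1 then ε else 0
  realArr _ _ _ := 0

/-- With access to the proximity oracle, the program `P` on the instance `(G, k)` (with `α` and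
`ε`) halts after exactly `t` steps, with the indicator matrix of the edge set `F` in array `1`. -/
def Outputs (P : Program) (n : ℕ) (G : SimpleGraph (Fin n)) (k : ℕ) (α ε : ℝ) (t : ℕ)
    (F : Finset (Sym2 (Fin n))) : Prop :=
  ∃ τ : Store, Runs (proximityOracle n α) P (inputStore n G k α ε) t τ ∧
    ∀ i j : Fin n, τ.natArr 1 i j = if s(i, j) ∈ F then 1 else 0

/-- Size of the instance: number of vertices plus the binary length of the budget. -/
def inputSize (n k : ℕ) : ℕ := n + Nat.size k

end Algorithms

/-! Let `F` be any set of at most `k` new edges and `W` the set of its endpoints, so that `W` has at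
most `2k` elements. If `u` and `v` are connected after sampling `G + F`, then either edges of `G`
alone connect them, or edges of `G` connect `u` to some `s` in `W` and `v` to some `t ≠ s` in `W`,
and some edge of `F` has survived (`reachable_or_linkEvent`). Conversely, adding the single edge
`st` to `G` turns this link event into a connection with probability at least `α` times that of the
event. A union bound then gives two estimates (`exists_covering_pairs`). If `c` bounds the proximity
of `u, v` in `G` and in every `G + st`, their proximity in `G + F` is at most `c (1 + k |D|)`, where
`D` is the set of ordered pairs of distinct elements of `W`; moreover, `α` times that proximity is
at most `c (1 + |D|)`. Read backwards, for `c` a suitable fraction of the optimum, every pair of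
vertices reaches proximity `c` in `G` or through one edge of `D` (`coverable_broadcast_mul`).

This is a set cover instance: the `n²` ordered pairs of vertices are covered by at most `m = 4
min(k, n)²` single edges. Since proximity grows with the graph, the greedy choice reaches a fraction
`1/m` of the unreached pairs in each step, hence all of them after `2m ⌈log₂ n⌉` steps
(`GreedyReach.le_proximity`).

The right threshold is unknown, but it may be raised to one of the at most `n⁴` proximities
occurring in graphs `G + st` (`Coverable.exists_eq_proximity`). The program tries all of these
exactly and keeps the graph of best broadcast, so no rounding loss occurs. The same program serves
both parts. Its correctness is proved with loop invariants, and its running time is read off its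
syntax once the rounds of every loop are bounded. -/

open Classical in
/-- The probability of the event `A` when every element of `E` is kept, independently, with
probability `α`. -/
noncomputable def percProb {β : Type*} (E : Finset β) (α : ℝ) (A : Finset β → Prop) : ℝ :=
  ∑ S ∈ E.powerset, if A S then α ^ S.card * (1 - α) ^ (E.card - S.card) else 0

/-! ### Independent sampling of a finite set -/

section Percolation

variable {β : Type*} {E : Finset β} {α : ℝ}

/-- Conditioning on whether `e` survives; inductions on the ground set rest on this formula. -/
theorem percProb_insert [DecidableEq β] {e : β} (he : e ∉ E) (α : ℝ) (A : Finset β → Prop) :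
    percProb (insert e E) α A =
      α * percProb E α (fun S => A (insert e S)) + (1 - α) * percProb E α A := by
  unfold percProb
  rw [Finset.sum_powerset_insert he, Finset.mul_sum, Finset.mul_sum, add_comm]
  congr 1
  · refine Finset.sum_congr rfl fun S hS => ?_
    have hS' : S ⊆ E := Finset.mem_powerset.1 hS
    have heS : e ∉ S := fun h => he (hS' h)
    rw [Finset.card_insert_of_notMem heS, Finset.card_insert_of_notMem he,
      Nat.add_sub_add_right]
    split_ifs <;> ring
  · refine Finset.sum_congr rfl fun S hS => ?_
    have hS' : S ⊆ E := Finset.mem_powerset.1 hS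
    have heS : e ∉ S := fun h => he (hS' h)
    rw [Finset.card_insert_of_notMem he, Nat.sub_add_comm (Finset.card_le_card hS')]
    split_ifs <;> ring

theorem percProb_nonneg (h0 : 0 ≤ α) (h1 : α ≤ 1) (A : Finset β → Prop) :
    0 ≤ percProb E α A := by
  classical
  refine Finset.sum_nonneg fun S _ => ?_
  have : 0 ≤ 1 - α := by linarith
  split_ifs <;> positivity

theorem percProb_mono (h0 : 0 ≤ α) (h1 : α ≤ 1) {A B : Finset β → Prop}
    (h : ∀ S ⊆ E, A S → B S) : percProb E α A ≤ percProb E α B := by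
  classical
  refine Finset.sum_le_sum fun S hS => ?_
  have : 0 ≤ 1 - α := by linarith
  by_cases hA : A S
  · rw [if_pos hA, if_pos (h S (Finset.mem_powerset.1 hS) hA)]
  · rw [if_neg hA]
    split_ifs <;> positivity

theorem percProb_congr {A B : Finset β → Prop} (h : ∀ S ⊆ E, (A S ↔ B S)) :
    percProb E α A = percProb E α B := by
  classical
  refine Finset.sum_congr rfl fun S hS => ?_
  simp only [h S (Finset.mem_powerset.1 hS)]

theorem percProb_false {A : Finset β → Prop} (h : ∀ S ⊆ E, ¬ A S) : percProb E α A = 0 := by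
  classical
  refine Finset.sum_eq_zero fun S hS => ?_
  rw [if_neg (h S (Finset.mem_powerset.1 hS))]

theorem percProb_true : percProb E α (fun _ => True) = 1 := by
  classical
  induction E using Finset.induction_on with
  | empty => simp [percProb]
  | insert e E he ih => rw [percProb_insert he, ih]; ring

theorem percProb_or_le (h0 : 0 ≤ α) (h1 : α ≤ 1) (A B : Finset β → Prop) :
    percProb E α (fun S => A S ∨ B S) ≤ percProb E α A + percProb E α B := by
  classical
  unfold percProb
  rw [← Finset.sum_add_distrib]
  refine Finset.sum_le_sum fun S _ => ?_
  have : 0 ≤ 1 - α := by linarith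
  have : 0 ≤ α ^ S.card * (1 - α) ^ (E.card - S.card) := by positivity
  by_cases hA : A S <;> by_cases hB : B S <;> simp [hA, hB, this]

theorem percProb_exists_le {ι : Type*} (h0 : 0 ≤ α) (h1 : α ≤ 1) (s : Finset ι)
    (A : ι → Finset β → Prop) :
    percProb E α (fun S => ∃ i ∈ s, A i S) ≤ ∑ i ∈ s, percProb E α (A i) := by
  classical
  induction s using Finset.induction_on with
  | empty => rw [percProb_false (by simp)]; simp
  | insert i s hi ih =>
    rw [Finset.sum_insert hi]
    refine le_trans (le_of_eq (percProb_congr fun S _ => ?_))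
      ((percProb_or_le h0 h1 (A i) (fun S => ∃ i ∈ s, A i S)).trans (add_le_add_right ih _))
    simp

/-- An event that depends on the elements of `E` only has the same probability in every larger
ground set. -/
theorem percProb_union_inter [DecidableEq β] (E F : Finset β) (α : ℝ) (A : Finset β → Prop) :
    percProb (E ∪ F) α (fun S => A (S ∩ E)) = percProb E α A := by
  induction F using Finset.induction_on with
  | empty =>
    rw [Finset.union_empty]
    exact percProb_congr fun S hS => by rw [Finset.inter_eq_left.2 hS]
  | insert f F hf ih =>
    rw [Finset.union_insert]
    by_cases h : f ∈ E ∪ F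
    · rw [Finset.insert_eq_of_mem h, ih]
    · have hE : f ∉ E := fun h' => h (Finset.mem_union_left _ h')
      rw [percProb_insert h]
      simp only [Finset.insert_inter_of_notMem hE, ih]
      ring

theorem percProb_le_of_subset (h0 : 0 ≤ α) (h1 : α ≤ 1) {E' : Finset β} (hE : E ⊆ E')
    {A : Finset β → Prop} (hA : Monotone A) : percProb E α A ≤ percProb E' α A := by
  classical
  rw [← percProb_union_inter E E' α A, Finset.union_eq_right.2 hE]
  exact percProb_mono h0 h1 fun S _ => hA Finset.inter_subset_left

/-- Opening one element independently of an event of `E`. -/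
theorem percProb_mem_and_inter [DecidableEq β] {f : β} (F : Finset β) (hf : f ∈ F) (hfE : f ∉ E) (α : ℝ)
    (A : Finset β → Prop) :
    percProb (E ∪ F) α (fun S => f ∈ S ∧ A (S ∩ E)) = α * percProb E α A := by
  have hins : E ∪ F = insert f (E ∪ F.erase f) := by
    rw [← Finset.union_insert, Finset.insert_erase hf]
  have hnot : f ∉ E ∪ F.erase f := by simp [hfE]
  rw [hins, percProb_insert hnot]
  have h1 : percProb (E ∪ F.erase f) α (fun S => f ∈ insert f S ∧ A (insert f S ∩ E)) =
      percProb E α A := by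
    rw [← percProb_union_inter E (F.erase f) α A]
    exact percProb_congr fun S _ => by simp [Finset.insert_inter_of_notMem hfE]
  rw [h1, percProb_false (A := fun S => f ∈ S ∧ A (S ∩ E)) fun S hS h => hnot (hS h.1)]
  ring

/-- If `e` is new, this is independence. But `e` may already lie in `E`, and then `B` may depend on
it; monotonicity of `B` makes the survival of `e` only help `B`, so the factor `α` still suffices.
-/
theorem mul_percProb_le_insert [DecidableEq β] (h0 : 0 ≤ α) (h1 : α ≤ 1) (e : β) {A B : Finset β → Prop}
    (hB : Monotone B) (hBA : ∀ S, B S → A (insert e S)) :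
    α * percProb E α B ≤ percProb (insert e E) α A := by
  have key : ∀ E : Finset β, e ∉ E → α * percProb (insert e E) α B ≤
      percProb (insert e E) α A := by
    intro E he
    have hα : 0 ≤ 1 - α := by linarith
    have hA0 := percProb_nonneg (E := E) h0 h1 A
    have hBi : percProb E α B ≤ percProb E α (fun S => B (insert e S)) :=
      percProb_mono h0 h1 fun S _ => hB (Finset.subset_insert e S)
    have hBA' : percProb E α (fun S => B (insert e S)) ≤
        percProb E α (fun S => A (insert e S)) :=
      percProb_mono h0 h1 fun S _ h => by simpa using hBA _ h
    rw [percProb_insert he α B, percProb_insert he α A]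
    have h2 : α * percProb E α (fun S => B (insert e S)) + (1 - α) * percProb E α B ≤
        percProb E α (fun S => B (insert e S)) := by
      nlinarith [mul_le_mul_of_nonneg_left hBi hα]
    nlinarith [mul_le_mul_of_nonneg_left (h2.trans hBA') h0, mul_nonneg hα hA0]
  refine (mul_le_mul_of_nonneg_left
    (percProb_le_of_subset h0 h1 (Finset.subset_insert e E) hB) h0).trans ?_
  have := key (E.erase e) (Finset.notMem_erase e E)
  rwa [show insert e (E.erase e) = insert e E by ext x; by_cases x = e <;> simp_all] at this

end Percolation

/-! ### Proximity as a sampling probability -/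

section Proximity

variable {V : Type*}

theorem monotone_reachable_fromEdgeSet (u v : V) :
    Monotone fun S : Finset (Sym2 V) =>
      (SimpleGraph.fromEdgeSet (S : Set (Sym2 V))).Reachable u v :=
  fun _ _ h => SimpleGraph.Reachable.mono (SimpleGraph.fromEdgeSet_mono (by exact_mod_cast h))

/-- The event that `u` is connected to `s` and `t` to `v`. -/
def linkEvent (u v s t : V) (S : Finset (Sym2 V)) : Prop :=
  (SimpleGraph.fromEdgeSet (S : Set (Sym2 V))).Reachable u s ∧
    (SimpleGraph.fromEdgeSet (S : Set (Sym2 V))).Reachable t v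

theorem monotone_linkEvent (u v s t : V) : Monotone (linkEvent u v s t) :=
  fun _ _ h hS => ⟨monotone_reachable_fromEdgeSet u s h hS.1,
    monotone_reachable_fromEdgeSet t v h hS.2⟩

variable [Fintype V]

theorem proximity_eq_percProb {G : SimpleGraph V} {E : Finset (Sym2 V)}
    (hE : (E : Set (Sym2 V)) = G.edgeSet) (α : ℝ) (u v : V) :
    proximity G α u v =
      percProb E α fun S => (SimpleGraph.fromEdgeSet (S : Set (Sym2 V))).Reachable u v := by
  classical
  have : E = G.edgeFinset := by
    ext e; rw [SimpleGraph.mem_edgeFinset, ← hE, Finset.mem_coe]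
  subst this
  unfold proximity percProb
  refine Finset.sum_congr (by congr) fun S hS => ?_
  rw [Finset.card_sdiff_of_subset (Finset.mem_powerset.1 hS)]
  congr

theorem exists_finset_coe_eq_edgeSet (G : SimpleGraph V) :
    ∃ E : Finset (Sym2 V), (E : Set (Sym2 V)) = G.edgeSet := by
  classical
  exact ⟨G.edgeFinset, by simp⟩

variable {G : SimpleGraph V} {α : ℝ}

theorem proximity_self (G : SimpleGraph V) (α : ℝ) (u : V) : proximity G α u u = 1 := by
  obtain ⟨E, hE⟩ := exists_finset_coe_eq_edgeSet G
  rw [proximity_eq_percProb hE, ← percProb_true (E := E) (α := α)]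
  exact percProb_congr fun S _ => by simp

theorem proximity_nonneg (h0 : 0 ≤ α) (h1 : α ≤ 1) (u v : V) : 0 ≤ proximity G α u v := by
  obtain ⟨E, hE⟩ := exists_finset_coe_eq_edgeSet G
  rw [proximity_eq_percProb hE]
  exact percProb_nonneg h0 h1 _

theorem proximity_le_one (h0 : 0 ≤ α) (h1 : α ≤ 1) (u v : V) : proximity G α u v ≤ 1 := by
  obtain ⟨E, hE⟩ := exists_finset_coe_eq_edgeSet G
  rw [proximity_eq_percProb hE, ← percProb_true (E := E) (α := α)]
  exact percProb_mono h0 h1 fun _ _ _ => trivial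

theorem proximity_mono (h0 : 0 ≤ α) (h1 : α ≤ 1) {G' : SimpleGraph V} (h : G ≤ G') (u v : V) :
    proximity G α u v ≤ proximity G' α u v := by
  obtain ⟨E, hE⟩ := exists_finset_coe_eq_edgeSet G
  obtain ⟨E', hE'⟩ := exists_finset_coe_eq_edgeSet G'
  rw [proximity_eq_percProb hE, proximity_eq_percProb hE']
  refine percProb_le_of_subset h0 h1 ?_ (monotone_reachable_fromEdgeSet u v)
  rw [← Finset.coe_subset, hE, hE']
  exact SimpleGraph.edgeSet_mono h

theorem broadcast_le_proximity (h0 : 0 ≤ α) (h1 : α ≤ 1) (u v : V) :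
    broadcast G α ≤ proximity G α u v :=
  ciInf_le (f := fun p : V × V => proximity G α p.1 p.2)
    ⟨0, by rintro _ ⟨p, rfl⟩; exact proximity_nonneg h0 h1 _ _⟩ (u, v)

/-- When the added edge survives, it joins the two halves of the link event into a connection from
`u` to `v`. The edge may already belong to `G`. -/
theorem mul_linkEvent_le_proximity (h0 : 0 ≤ α) (h1 : α ≤ 1) {E : Finset (Sym2 V)}
    (hE : (E : Set (Sym2 V)) = G.edgeSet) (u v : V) {s t : V} (hst : s ≠ t) :
    α * percProb E α (linkEvent u v s t) ≤ proximity (G ⊔ SimpleGraph.edge s t) α u v := by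
  classical
  rw [proximity_eq_percProb (E := insert s(s, t) E)
    (by rw [SimpleGraph.edgeSet_sup, SimpleGraph.edgeSet_edge_of_ne hst, ← hE,
      Finset.coe_insert, Set.insert_eq, Set.union_comm])]
  refine mul_percProb_le_insert h0 h1 _ (monotone_linkEvent u v s t) fun S hS => ?_
  have hS' := monotone_linkEvent u v s t (Finset.subset_insert s(s, t) S) hS
  refine (hS'.1.trans (SimpleGraph.Adj.reachable ?_)).trans hS'.2
  simp [hst]

end Proximity

/-! ### Covering pairs by single edges -/

section Cover

variable {V : Type*}

/-- If `u` and `v` are connected by edges of `E ∪ F`, then they are connected by edges of `E`, or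
edges of `E` connect them to two distinct endpoints of edges of `F`, of which one is present. -/
theorem reachable_or_linkEvent [DecidableEq V] {E F S : Finset (Sym2 V)} (hS : S ⊆ E ∪ F)
    {W : Finset V} (hW : ∀ f ∈ F, ∀ x ∈ f, x ∈ W) {u v : V}
    (h : (SimpleGraph.fromEdgeSet (S : Set (Sym2 V))).Reachable u v) :
    (SimpleGraph.fromEdgeSet ((S ∩ E : Finset (Sym2 V)) : Set (Sym2 V))).Reachable u v ∨
      (∃ f ∈ F, f ∈ S) ∧ ∃ p ∈ W.offDiag, linkEvent u v p.1 p.2 (S ∩ E) := by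
  obtain ⟨p⟩ := h
  -- Along the walk, `s` and `t` are the outermost endpoints of its edges outside `E`. The induction
  -- allows `s = t`; in that case the two halves already connect `u` to `v` inside `E`.
  suffices H : (SimpleGraph.fromEdgeSet ((S ∩ E : Finset (Sym2 V)) : Set (Sym2 V))).Reachable u v ∨
      (∃ f ∈ F, f ∈ S) ∧ ∃ s ∈ W, ∃ t ∈ W, linkEvent u v s t (S ∩ E) by
    rcases H with H | ⟨hf, s, hs, t, ht, H⟩
    · exact Or.inl H
    · by_cases hst : s = t
      · subst hst
        exact Or.inl (H.1.trans H.2)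
      · exact Or.inr ⟨hf, (s, t), Finset.mem_offDiag.2 ⟨hs, ht, hst⟩, H⟩
  induction p with
  | nil => exact Or.inl (SimpleGraph.Reachable.refl _)
  | @cons u w v huw p ih =>
    obtain ⟨hmem, hne⟩ := (SimpleGraph.fromEdgeSet_adj _).1 huw
    have hmem : s(u, w) ∈ S := hmem
    by_cases hE : s(u, w) ∈ E
    · have hr : (SimpleGraph.fromEdgeSet
          ((S ∩ E : Finset (Sym2 V)) : Set (Sym2 V))).Reachable u w :=
        SimpleGraph.Adj.reachable
          ((SimpleGraph.fromEdgeSet_adj _).2 ⟨Finset.mem_inter.2 ⟨hmem, hE⟩, hne⟩)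
      rcases ih with ih | ⟨hf, s, hs, t, ht, h1, h2⟩
      · exact Or.inl (hr.trans ih)
      · exact Or.inr ⟨hf, s, hs, t, ht, hr.trans h1, h2⟩
    · have hF : s(u, w) ∈ F := (Finset.mem_union.1 (hS hmem)).resolve_left hE
      have hu := hW _ hF u (Sym2.mem_mk_left u w)
      have hw := hW _ hF w (Sym2.mem_mk_right u w)
      rcases ih with ih | ⟨-, s, -, t, ht, -, h2⟩
      · exact Or.inr ⟨⟨_, hF, hmem⟩, u, hu, w, hw, SimpleGraph.Reachable.refl _, ih⟩
      · exact Or.inr ⟨⟨_, hF, hmem⟩, u, hu, t, ht, SimpleGraph.Reachable.refl _, h2⟩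

theorem exists_endpoints [Fintype V] [DecidableEq V] (F : Finset (Sym2 V)) :
    ∃ W : Finset V, (∀ f ∈ F, ∀ x ∈ f, x ∈ W) ∧ W.card ≤ 2 * F.card := by
  refine ⟨F.biUnion Sym2.toFinset, fun f hf x hx =>
    Finset.mem_biUnion.2 ⟨f, hf, Sym2.mem_toFinset.2 hx⟩, ?_⟩
  rw [mul_comm]
  refine Finset.card_biUnion_le_card_mul _ _ _ fun f _ => ?_
  rw [Sym2.card_toFinset]
  split_ifs <;> omega

variable [Fintype V] {G : SimpleGraph V} {α : ℝ}

/-- Few additional edges suffice to give every pair of vertices, one of these edges at a time, a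
proximity that is comparable to its proximity in `G + F`. -/
theorem exists_covering_pairs (h0 : 0 ≤ α) (h1 : α ≤ 1) {F : Finset (Sym2 V)}
    (hF : IsAugmentation G F) {k : ℕ} (hk : F.card ≤ k) :
    ∃ D : Finset (V × V), D.card ≤ 2 * k * (2 * k - 1) ∧
      D.card ≤ 4 * min k (Fintype.card V) ^ 2 ∧ ∀ (u v : V) (c : ℝ),
      proximity G α u v ≤ c →
      (∀ p ∈ D, proximity (G ⊔ SimpleGraph.edge p.1 p.2) α u v ≤ c) →
      proximity (addEdges G F) α u v ≤ c * (1 + k * D.card) ∧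
        α * proximity (addEdges G F) α u v ≤ c * (1 + D.card) := by
  classical
  obtain ⟨W, hW, hWc⟩ := exists_endpoints F
  have hWk : W.card ≤ 2 * k := hWc.trans (Nat.mul_le_mul_left 2 hk)
  have hWV : W.card ≤ Fintype.card V := Finset.card_le_univ W
  -- Two size bounds are kept: the count without the diagonal is sharp enough for the constant at `k
  -- = 1`, and the bound through the number of vertices keeps the greedy process short when `k` is
  -- exponential in the input size.
  refine ⟨W.offDiag, ?_, ?_, ?_⟩
  · rw [Finset.offDiag_card, ← Nat.mul_sub_one]
    exact Nat.mul_le_mul hWk (Nat.sub_le_sub_right hWk 1)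
  · rw [Finset.offDiag_card]
    have h : W.card ≤ 2 * min k (Fintype.card V) := by omega
    calc _ ≤ W.card * W.card := Nat.sub_le _ _
      _ ≤ (2 * min k (Fintype.card V)) * (2 * min k (Fintype.card V)) := Nat.mul_le_mul h h
      _ = _ := by ring
  intro u v c hc hD
  obtain ⟨E, hE⟩ := exists_finset_coe_eq_edgeSet G
  have hFE : ∀ f ∈ F, f ∉ E := by
    intro f hf hfE
    have h2 : f ∈ Gᶜ.edgeSet := hF hf
    have h3 : f ∈ G.edgeSet := by rw [← hE]; exact hfE
    induction f using Sym2.ind with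
    | _ x y => exact ((SimpleGraph.compl_adj _ _ _).1 h2).2 h3
  have hEF : ((E ∪ F : Finset (Sym2 V)) : Set (Sym2 V)) = (addEdges G F).edgeSet := by
    rw [addEdges, SimpleGraph.edgeSet_sup, ← hE, SimpleGraph.edgeSet_fromEdgeSet,
      Finset.coe_union]
    congr 1
    refine (sdiff_eq_left.2 (Set.disjoint_left.2 fun f hf hd => ?_)).symm
    exact SimpleGraph.not_isDiag_of_mem_edgeSet _ (hF hf) hd
  have hc0 : 0 ≤ c := (proximity_nonneg h0 h1 u v).trans hc
  have hlink : ∀ p ∈ W.offDiag, α * percProb E α (linkEvent u v p.1 p.2) ≤ c := fun p hp =>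
    (mul_linkEvent_le_proximity h0 h1 hE u v (Finset.mem_offDiag.1 hp).2.2).trans (hD p hp)
  have hG : percProb (E ∪ F) α (fun S => (SimpleGraph.fromEdgeSet
      ((S ∩ E : Finset (Sym2 V)) : Set (Sym2 V))).Reachable u v) ≤ c := by
    refine le_trans (le_of_eq ?_) hc
    rw [proximity_eq_percProb hE]
    exact percProb_union_inter E F α
      fun S => (SimpleGraph.fromEdgeSet (S : Set (Sym2 V))).Reachable u v
  rw [proximity_eq_percProb hEF]
  constructor
  -- Remember which edge of `F` survives. As `F` is disjoint from `E`, this edge is independent of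
  -- the link event and supplies the factor `α` that `hlink` needs; the union bound pays a factor
  -- `k` for it.
  · have hsplit : ∀ S ⊆ E ∪ F, (SimpleGraph.fromEdgeSet (S : Set (Sym2 V))).Reachable u v →
        ((SimpleGraph.fromEdgeSet ((S ∩ E : Finset (Sym2 V)) : Set (Sym2 V))).Reachable u v ∨
        ∃ q ∈ F ×ˢ W.offDiag, q.1 ∈ S ∧ linkEvent u v q.2.1 q.2.2 (S ∩ E)) := by
      intro S hS hr
      rcases reachable_or_linkEvent hS hW hr with h | ⟨⟨f, hf, hfS⟩, p, hp, h⟩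
      · exact Or.inl h
      · exact Or.inr ⟨(f, p), Finset.mem_product.2 ⟨hf, hp⟩, hfS, h⟩
    refine (percProb_mono h0 h1 hsplit).trans ((percProb_or_le h0 h1 _ _).trans ?_)
    have hsum : percProb (E ∪ F) α (fun S => ∃ q ∈ F ×ˢ W.offDiag, q.1 ∈ S ∧
        linkEvent u v q.2.1 q.2.2 (S ∩ E)) ≤ (F ×ˢ W.offDiag).card • c := by
      refine (percProb_exists_le h0 h1 (F ×ˢ W.offDiag)
        fun q S => q.1 ∈ S ∧ linkEvent u v q.2.1 q.2.2 (S ∩ E)).trans ?_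
      refine Finset.sum_le_card_nsmul _ _ _ fun q hq => ?_
      obtain ⟨hq1, hq2⟩ := Finset.mem_product.1 hq
      rw [percProb_mem_and_inter F hq1 (hFE _ hq1) α (linkEvent u v q.2.1 q.2.2)]
      exact hlink _ hq2
    rw [Finset.card_product, nsmul_eq_mul, Nat.cast_mul] at hsum
    have hkF : (F.card : ℝ) * W.offDiag.card * c ≤ k * W.offDiag.card * c := by
      gcongr
    linarith
  -- Forget the surviving edge. The union runs over pairs only, but the factor `α` has to be put in
  -- by hand on both sides.
  · have hsplit : ∀ S ⊆ E ∪ F, (SimpleGraph.fromEdgeSet (S : Set (Sym2 V))).Reachable u v →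
        ((SimpleGraph.fromEdgeSet ((S ∩ E : Finset (Sym2 V)) : Set (Sym2 V))).Reachable u v ∨
        ∃ q ∈ W.offDiag, linkEvent u v q.1 q.2 (S ∩ E)) := fun S hS hr =>
      (reachable_or_linkEvent hS hW hr).imp_right And.right
    have hle := (percProb_mono h0 h1 hsplit).trans (percProb_or_le h0 h1 _ _)
    have hsum : α * percProb (E ∪ F) α (fun S => ∃ q ∈ W.offDiag,
        linkEvent u v q.1 q.2 (S ∩ E)) ≤ W.offDiag.card • c := by
      refine (mul_le_mul_of_nonneg_left (percProb_exists_le h0 h1 W.offDiag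
        fun q S => linkEvent u v q.1 q.2 (S ∩ E)) h0).trans ?_
      rw [Finset.mul_sum]
      refine Finset.sum_le_card_nsmul _ _ _ fun q hq => ?_
      rw [percProb_union_inter E F α (linkEvent u v q.1 q.2)]
      exact hlink _ hq
    rw [nsmul_eq_mul] at hsum
    have h2 := mul_le_mul_of_nonneg_left hle h0
    have h3 := mul_le_mul_of_nonneg_left hG h0
    have h4 := mul_le_mul_of_nonneg_right h1 hc0
    linarith

/-! ### Greedy covering -/

/-- Every pair of vertices has proximity at least `c`, or gets it from one additional edge
chosen from a set of at most `m` pairs. -/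
def Coverable (G : SimpleGraph V) (α : ℝ) (m : ℕ) (c : ℝ) : Prop :=
  ∃ D : Finset (V × V), D.card ≤ m ∧ ∀ u v : V, c ≤ proximity G α u v ∨
    ∃ p ∈ D, c ≤ proximity (G ⊔ SimpleGraph.edge p.1 p.2) α u v

open Classical in
/-- The number of pairs of vertices with proximity at least `c`. -/
noncomputable def numReached (G : SimpleGraph V) (α c : ℝ) : ℕ :=
  (Finset.univ.filter fun p : V × V => c ≤ proximity G α p.1 p.2).card

/-- `K` arises from `G` in `i` steps, each adding one edge so as to maximize `numReached`. -/
inductive GreedyReach (G : SimpleGraph V) (α c : ℝ) : ℕ → SimpleGraph V → Prop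
  | zero : GreedyReach G α c 0 G
  | step (i : ℕ) (K : SimpleGraph V) (s t : V) (hK : GreedyReach G α c i K)
      (hmax : ∀ s' t' : V, numReached (K ⊔ SimpleGraph.edge s' t') α c ≤
        numReached (K ⊔ SimpleGraph.edge s t) α c) :
      GreedyReach G α c (i + 1) (K ⊔ SimpleGraph.edge s t)

theorem GreedyReach.le {c : ℝ} {i : ℕ} {K : SimpleGraph V} (h : GreedyReach G α c i K) :
    G ≤ K := by
  induction h with
  | zero => exact le_rfl
  | step i K s t _ _ ih => exact ih.trans le_sup_left

theorem GreedyReach.exists_addEdges {c : ℝ} {i : ℕ} {K : SimpleGraph V}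
    (h : GreedyReach G α c i K) : ∃ F : Finset (Sym2 V), F.card ≤ i ∧ K = addEdges G F := by
  classical
  induction h with
  | zero => exact ⟨∅, by simp, by simp [addEdges]⟩
  | step i K s t _ _ ih =>
    obtain ⟨F, hF, rfl⟩ := ih
    refine ⟨insert s(s, t) F, (Finset.card_insert_le _ _).trans (by omega), ?_⟩
    rw [addEdges, addEdges, sup_assoc, SimpleGraph.edge, ← SimpleGraph.fromEdgeSet_union,
      Finset.coe_insert, Set.insert_eq, Set.union_comm]

theorem numReached_add_card (G : SimpleGraph V) (α c : ℝ) [DecidableEq V]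
    [DecidablePred fun p : V × V => ¬ c ≤ proximity G α p.1 p.2] :
    numReached G α c + (Finset.univ.filter fun p : V × V => ¬ c ≤ proximity G α p.1 p.2).card =
      Fintype.card V ^ 2 := by
  classical
  have h := Finset.card_filter_add_card_filter_not (s := (Finset.univ : Finset (V × V)))
    (fun p => c ≤ proximity G α p.1 p.2)
  rw [Finset.card_univ, Fintype.card_prod, ← sq] at h
  rw [← h, numReached]

/-- A cover for `G` is a cover for every larger `K`, by monotonicity of proximity. By pigeonhole one
of its at most `m` edges reaches a fraction `1/m` of the pairs still unreached, and the greedy edge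
does at least as well. -/
theorem GreedyReach.unreached_le (h0 : 0 ≤ α) (h1 : α ≤ 1) {c : ℝ} {m i : ℕ} (hm : 0 < m)
    (hcov : Coverable G α m c) {K : SimpleGraph V} (h : GreedyReach G α c i K) :
    (Fintype.card V : ℝ) ^ 2 - numReached K α c ≤
      (1 - 1 / (m : ℝ)) ^ i * (Fintype.card V : ℝ) ^ 2 := by
  classical
  induction h with
  | zero => simp
  | step i K s t hK hmax ih =>
    have hm' : (1 : ℝ) ≤ m := by exact_mod_cast hm
    have hq : 0 ≤ 1 - 1 / (m : ℝ) := by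
      rw [sub_nonneg, div_le_one (by linarith)]; exact hm'
    obtain ⟨D, hD, hcov⟩ := hcov
    set U := Finset.univ.filter fun p : V × V => ¬ c ≤ proximity K α p.1 p.2 with hU
    set K' := K ⊔ SimpleGraph.edge s t with hK'
    have hUK := numReached_add_card K α c
    rw [← hU] at hUK
    have hcount : ∀ q ∈ D, (U.filter fun p =>
        c ≤ proximity (K ⊔ SimpleGraph.edge q.1 q.2) α p.1 p.2).card + numReached K α c ≤
        numReached K' α c := by
      intro q _
      refine le_trans ?_ (hmax q.1 q.2)
      rw [numReached, numReached, ← Finset.card_union_of_disjoint]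
      · refine Finset.card_le_card fun p hp => ?_
        rcases Finset.mem_union.1 hp with hp | hp
        · exact Finset.mem_filter.2 ⟨Finset.mem_univ _, (Finset.mem_filter.1 hp).2⟩
        · exact Finset.mem_filter.2 ⟨Finset.mem_univ _,
            (Finset.mem_filter.1 hp).2.trans (proximity_mono h0 h1 le_sup_left _ _)⟩
      · rw [Finset.disjoint_left]
        intro p hp hp'
        exact (Finset.mem_filter.1 (Finset.mem_filter.1 hp).1).2 (Finset.mem_filter.1 hp').2
    have hUD : U ⊆ D.biUnion fun q => U.filter fun p =>
        c ≤ proximity (K ⊔ SimpleGraph.edge q.1 q.2) α p.1 p.2 := by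
      intro p hp
      rcases hcov p.1 p.2 with h | ⟨q, hq, h⟩
      · exact absurd (h.trans (proximity_mono h0 h1 hK.le _ _)) (Finset.mem_filter.1 hp).2
      · exact Finset.mem_biUnion.2 ⟨q, hq, Finset.mem_filter.2 ⟨hp,
          h.trans (proximity_mono h0 h1 (sup_le_sup_right hK.le _) _ _)⟩⟩
    have hle : numReached K α c ≤ numReached K' α c := by
      refine Finset.card_le_card fun p hp => ?_
      exact Finset.mem_filter.2 ⟨Finset.mem_univ _,
        (Finset.mem_filter.1 hp).2.trans (proximity_mono h0 h1 le_sup_left _ _)⟩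
    have hUm : U.card ≤ m * (numReached K' α c - numReached K α c) :=
      ((Finset.card_le_card hUD).trans (Finset.card_biUnion_le_card_mul _ _ _
        fun q hq => Nat.le_sub_of_add_le (hcount q hq))).trans (Nat.mul_le_mul_right _ hD)
    have hUm' : (U.card : ℝ) ≤ m * ((numReached K' α c : ℝ) - numReached K α c) := by
      rw [← Nat.cast_sub hle]; exact_mod_cast hUm
    have hUK' : (numReached K α c : ℝ) + U.card = (Fintype.card V : ℝ) ^ 2 := by
      exact_mod_cast hUK
    rw [pow_succ' (1 - 1 / (m : ℝ)) i, mul_assoc]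
    refine le_trans ?_ (mul_le_mul_of_nonneg_left ih hq)
    have : (U.card : ℝ) / m ≤ (numReached K' α c : ℝ) - numReached K α c := by
      rw [div_le_iff₀ (by linarith)]; linarith
    rw [← hUK', sub_mul, one_mul, div_mul_eq_mul_div, one_mul, add_sub_cancel_left]
    linarith

/-- The greedy covering process reaches every pair of vertices. -/
theorem GreedyReach.le_proximity (h0 : 0 ≤ α) (h1 : α ≤ 1) {c : ℝ} {m : ℕ}
    (hV : 2 ≤ Fintype.card V) (hcov : Coverable G α m c) {K : SimpleGraph V}
    (h : GreedyReach G α c (2 * m * Nat.clog 2 (Fintype.card V)) K) (u v : V) :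
    c ≤ proximity K α u v := by
  classical
  -- With an empty cover no step is needed: `G` itself reaches every pair.
  rcases Nat.eq_zero_or_pos m with rfl | hm
  · obtain ⟨D, hD, hcov⟩ := hcov
    obtain rfl : D = ∅ := Finset.card_eq_zero.1 (Nat.le_zero.1 hD)
    rcases hcov u v with h' | ⟨q, hq, -⟩
    · exact h'.trans (proximity_mono h0 h1 h.le u v)
    · simp at hq
  set ℓ := Nat.clog 2 (Fintype.card V) with hℓ
  set n := Fintype.card V with hn
  have hm' : (1 : ℝ) ≤ m := by exact_mod_cast hm
  have hq : 0 ≤ 1 - 1 / (m : ℝ) := by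
    rw [sub_nonneg, div_le_one (by linarith)]; exact hm'
  have hle := h.unreached_le h0 h1 hm hcov
  have hℓ0 : ℓ ≠ 0 := (Nat.clog_pos one_lt_two hV).ne'
  have hn2 : n ≤ 2 ^ ℓ := Nat.le_pow_clog one_lt_two n
  have hpow : (1 - 1 / (m : ℝ)) ^ m < 1 / 2 := by
    have h2 : 1 - 1 / (m : ℝ) ≤ Real.exp (-(1 / m)) := by
      have := Real.add_one_le_exp (-(1 / (m : ℝ))); linarith
    refine (pow_le_pow_left₀ hq h2 m).trans_lt ?_
    rw [← Real.exp_nat_mul, mul_neg, mul_one_div_cancel (by linarith), Real.exp_neg, one_div]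
    have : (2 : ℝ) < Real.exp 1 := by have := Real.exp_one_gt_d9; linarith
    gcongr
  -- Each block of `m` steps more than halves the bound. The `n²` ordered pairs require `2ℓ` blocks,
  -- after which fewer than one pair, hence none, is unreached.
  have hlt : (1 - 1 / (m : ℝ)) ^ (2 * m * ℓ) * (n : ℝ) ^ 2 < 1 := by
    have e1 : (1 - 1 / (m : ℝ)) ^ (2 * m * ℓ) = (((1 - 1 / (m : ℝ)) ^ m) ^ ℓ) ^ 2 := by
      rw [← pow_mul, ← pow_mul]; congr 1; ring
    rw [e1, ← mul_pow]
    have e2 : ((1 - 1 / (m : ℝ)) ^ m) ^ ℓ * n < 1 := by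
      calc _ < (1 / 2 : ℝ) ^ ℓ * n := by
            have : (0 : ℝ) < n := by exact_mod_cast (by omega : 0 < n)
            have := pow_lt_pow_left₀ hpow (pow_nonneg hq m) hℓ0
            gcongr
        _ ≤ (1 / 2 : ℝ) ^ ℓ * 2 ^ ℓ := by gcongr; exact_mod_cast hn2
        _ = 1 := by rw [← mul_pow]; norm_num
    exact pow_lt_one₀ (mul_nonneg (pow_nonneg (pow_nonneg hq m) ℓ) n.cast_nonneg) e2 two_ne_zero
  have hcard := numReached_add_card K α c
  have hzero : (Finset.univ.filter fun p : V × V => ¬ c ≤ proximity K α p.1 p.2).card = 0 := by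
    have h3 : ((numReached K α c : ℝ)) +
      (Finset.univ.filter fun p : V × V => ¬ c ≤ proximity K α p.1 p.2).card = (n : ℝ) ^ 2 := by
      exact_mod_cast hcard
    have h4 : ((Finset.univ.filter fun p : V × V => ¬ c ≤ proximity K α p.1 p.2).card : ℝ) < 1 := by
      linarith
    exact Nat.lt_one_iff.1 (by exact_mod_cast h4)
  by_contra hc
  have := Finset.card_eq_zero.1 hzero
  have h5 : (u, v) ∈ (Finset.univ.filter fun p : V × V => ¬ c ≤ proximity K α p.1 p.2) :=
    Finset.mem_filter.2 ⟨Finset.mem_univ _, hc⟩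
  rw [this] at h5
  simp at h5

end Cover

/-! ### Program logic with running times -/

namespace OracleMachine

section Framework

/-- Whether the program writes to the natural-number register `x`. -/
def Program.writesNat : Program → ℕ → Bool
  | .setNat y _, x => x == y
  | .seq P Q, x => P.writesNat x || Q.writesNat x
  | .ite _ P Q, x => P.writesNat x || Q.writesNat x
  | .loop _ P, x => P.writesNat x
  | _, _ => false

/-- Whether the program writes to the real register `x`. -/
def Program.writesReal : Program → ℕ → Bool
  | .setReal y _, x => x == y
  | .query y _ _ _, x => x == y
  | .seq P Q, x => P.writesReal x || Q.writesReal x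
  | .ite _ P Q, x => P.writesReal x || Q.writesReal x
  | .loop _ P, x => P.writesReal x
  | _, _ => false

/-- Whether the program writes to the natural-number array `a`. -/
def Program.writesNatArr : Program → ℕ → Bool
  | .storeNat b _ _ _, a => a == b
  | .seq P Q, a => P.writesNatArr a || Q.writesNatArr a
  | .ite _ P Q, a => P.writesNatArr a || Q.writesNatArr a
  | .loop _ P, a => P.writesNatArr a
  | _, _ => false

/-- The stores `σ` and `τ` agree on everything that `P` does not write to. -/
structure Frame (P : Program) (σ τ : Store) : Prop where
  natReg : ∀ x, P.writesNat x = false → τ.natReg x = σ.natReg x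
  realReg : ∀ x, P.writesReal x = false → τ.realReg x = σ.realReg x
  natArr : ∀ a, P.writesNatArr a = false → τ.natArr a = σ.natArr a

theorem Frame.refl (P : Program) (σ : Store) : Frame P σ σ :=
  ⟨fun _ _ => rfl, fun _ _ => rfl, fun _ _ => rfl⟩

theorem Frame.trans {P : Program} {σ τ ρ : Store} (h : Frame P σ τ) (h' : Frame P τ ρ) :
    Frame P σ ρ :=
  ⟨fun x hx => (h'.natReg x hx).trans (h.natReg x hx),
    fun x hx => (h'.realReg x hx).trans (h.realReg x hx),
    fun x hx => (h'.natArr x hx).trans (h.natArr x hx)⟩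

theorem Frame.weaken {P Q : Program} {σ τ : Store} (h : Frame P σ τ)
    (h1 : ∀ x, Q.writesNat x = false → P.writesNat x = false)
    (h2 : ∀ x, Q.writesReal x = false → P.writesReal x = false)
    (h3 : ∀ x, Q.writesNatArr x = false → P.writesNatArr x = false) : Frame Q σ τ :=
  ⟨fun x hx => h.natReg x (h1 x hx), fun x hx => h.realReg x (h2 x hx),
    fun x hx => h.natArr x (h3 x hx)⟩

theorem Frame.setNatReg {P : Program} {x : ℕ} (hx : P.writesNat x = true) (σ : Store) (v : ℕ) :
    Frame P σ (σ.setNatReg x v) where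
  natReg y hy := by
    have : y ≠ x := fun h => by rw [h, hx] at hy; cases hy
    simp [Store.setNatReg, this]
  realReg _ _ := rfl
  natArr _ _ := rfl

variable {O : (ℕ → ℕ → ℕ) → ℕ → ℕ → ℝ}

/-- Invariants thus need to mention only what a loop changes; the rest is settled by computing the
syntactic `writes` predicates. -/
theorem Runs.frame {P : Program} {σ τ : Store} {t : ℕ} (h : Runs O P σ t τ) : Frame P σ τ := by
  induction h with
  | skip σ => exact Frame.refl _ _
  | setNat x e σ => exact Frame.setNatReg (by simp [Program.writesNat]) σ _
  | setReal x e σ =>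
    refine ⟨fun _ _ => rfl, fun y hy => ?_, fun _ _ => rfl⟩
    have : y ≠ x := by simpa [Program.writesReal] using hy
    simp [Store.setRealReg, this]
  | storeNat a i j e σ =>
    refine ⟨fun _ _ => rfl, fun _ _ => rfl, fun y hy => ?_⟩
    have : y ≠ a := by simpa [Program.writesNatArr] using hy
    simp [Store.setNatArr, this]
  | storeReal a i j e σ => exact ⟨fun _ _ => rfl, fun _ _ => rfl, fun _ _ => rfl⟩
  | query x a i j σ =>
    refine ⟨fun _ _ => rfl, fun y hy => ?_, fun _ _ => rfl⟩
    have : y ≠ x := by simpa [Program.writesReal] using hy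
    simp [Store.setRealReg, this]
  | seq P Q σ τ ρ s t _ _ h1 h2 =>
    refine Frame.trans (h1.weaken ?_ ?_ ?_) (h2.weaken ?_ ?_ ?_) <;>
      simp +contextual [Program.writesNat, Program.writesReal, Program.writesNatArr]
  | iteTrue b P Q σ τ t _ _ h1 =>
    refine h1.weaken ?_ ?_ ?_ <;>
      simp +contextual [Program.writesNat, Program.writesReal, Program.writesNatArr]
  | iteFalse b P Q σ τ t _ _ h1 =>
    refine h1.weaken ?_ ?_ ?_ <;>
      simp +contextual [Program.writesNat, Program.writesReal, Program.writesNatArr]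
  | loopTrue b P σ τ ρ s t _ _ _ h1 h2 =>
    exact Frame.trans (h1.weaken (fun _ h => h) (fun _ h => h) (fun _ h => h)) h2
  | loopFalse b P σ _ => exact Frame.refl _ _

/-- Bound on the running time of a program all of whose loops take at most `B` rounds. -/
def Program.bound (B : ℕ) : Program → ℕ
  | .skip => 1
  | .setNat _ e => 1 + e.cost
  | .setReal _ e => 1 + e.cost
  | .storeNat _ i j e => 1 + i.cost + j.cost + e.cost
  | .storeReal _ i j e => 1 + i.cost + j.cost + e.cost
  | .query _ _ i j => 1 + i.cost + j.cost
  | .seq P Q => P.bound B + Q.bound B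
  | .ite b P Q => 1 + b.cost + (P.bound B + Q.bound B)
  | .loop b P => (B + 1) * (1 + b.cost + P.bound B)

/-- The program is fixed, so its nesting depth is a constant, and each loop multiplies the bound by
`B + 1` times a polynomial. -/
theorem Program.exists_polynomial_bound (P : Program) :
    ∃ T : Polynomial ℕ, ∀ B, P.bound B = T.eval B := by
  induction P with
  | skip => exact ⟨1, fun B => by simp [bound]⟩
  | setNat x e => exact ⟨Polynomial.C (1 + e.cost), fun B => by rw [Polynomial.eval_C, bound]⟩
  | setReal x e => exact ⟨Polynomial.C (1 + e.cost), fun B => by rw [Polynomial.eval_C, bound]⟩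
  | storeNat a i j e =>
    exact ⟨Polynomial.C (1 + i.cost + j.cost + e.cost), fun B => by rw [Polynomial.eval_C, bound]⟩
  | storeReal a i j e =>
    exact ⟨Polynomial.C (1 + i.cost + j.cost + e.cost), fun B => by rw [Polynomial.eval_C, bound]⟩
  | query x a i j =>
    exact ⟨Polynomial.C (1 + i.cost + j.cost), fun B => by rw [Polynomial.eval_C, bound]⟩
  | seq P Q hP hQ =>
    obtain ⟨S, hS⟩ := hP
    obtain ⟨T, hT⟩ := hQ
    exact ⟨S + T, fun B => by rw [Polynomial.eval_add, bound, hS, hT]⟩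
  | ite b P Q hP hQ =>
    obtain ⟨S, hS⟩ := hP
    obtain ⟨T, hT⟩ := hQ
    exact ⟨Polynomial.C (1 + b.cost) + (S + T), fun B => by
      rw [Polynomial.eval_add, Polynomial.eval_add, Polynomial.eval_C, bound, hS, hT]⟩
  | loop b P hP =>
    obtain ⟨S, hS⟩ := hP
    exact ⟨(Polynomial.X + 1) * (Polynomial.C (1 + b.cost) + S), fun B => by
      rw [Polynomial.eval_mul, Polynomial.eval_add, Polynomial.eval_add, Polynomial.eval_C,
        Polynomial.eval_X, Polynomial.eval_one, bound, hS]⟩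

/-- Started in `σ`, the program `P` halts within the time `P.bound B` in a store satisfying `Q`. -/
def Halts (O : (ℕ → ℕ → ℕ) → ℕ → ℕ → ℝ) (B : ℕ) (P : Program) (σ : Store) (Q : Store → Prop) :
    Prop :=
  ∃ t τ, t ≤ P.bound B ∧ Runs O P σ t τ ∧ Q τ

variable {B : ℕ} {P P' : Program} {σ : Store} {Q Q' : Store → Prop}

theorem Halts.mono (h : Halts O B P σ Q) (hQ : ∀ τ, Frame P σ τ → Q τ → Q' τ) :
    Halts O B P σ Q' := by
  obtain ⟨t, τ, ht, hr, hτ⟩ := h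
  exact ⟨t, τ, ht, hr, hQ τ hr.frame hτ⟩

theorem Halts.seq (h : Halts O B P σ fun τ => Halts O B P' τ Q) : Halts O B (.seq P P') σ Q := by
  obtain ⟨s, τ, hs, hr, t, ρ, ht, hr', hρ⟩ := h
  exact ⟨s + t, ρ, Nat.add_le_add hs ht, Runs.seq _ _ _ _ _ _ _ hr hr', hρ⟩

theorem Halts.skip (h : Q σ) : Halts O B .skip σ Q := ⟨_, _, le_rfl, Runs.skip _, h⟩

theorem Halts.setNat {x : ℕ} {e : NatExpr} (h : Q (σ.setNatReg x (e.eval σ))) :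
    Halts O B (.setNat x e) σ Q := ⟨_, _, le_rfl, Runs.setNat _ _ _, h⟩

theorem Halts.setReal {x : ℕ} {e : RealExpr} (h : Q (σ.setRealReg x (e.eval σ))) :
    Halts O B (.setReal x e) σ Q := ⟨_, _, le_rfl, Runs.setReal _ _ _, h⟩

theorem Halts.storeNat {a : ℕ} {i j e : NatExpr}
    (h : Q (σ.setNatArr a (i.eval σ) (j.eval σ) (e.eval σ))) :
    Halts O B (.storeNat a i j e) σ Q := ⟨_, _, le_rfl, Runs.storeNat _ _ _ _ _, h⟩

theorem Halts.query {x a : ℕ} {i j : NatExpr}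
    (h : Q (σ.setRealReg x (O (σ.natArr a) (i.eval σ) (j.eval σ)))) :
    Halts O B (.query x a i j) σ Q := ⟨_, _, le_rfl, Runs.query _ _ _ _ _, h⟩

theorem Halts.ite {b : Test} (h : b.Holds σ → Halts O B P σ Q)
    (h' : ¬ b.Holds σ → Halts O B P' σ Q) : Halts O B (.ite b P P') σ Q := by
  by_cases hb : b.Holds σ
  · obtain ⟨t, τ, ht, hr, hτ⟩ := h hb
    exact ⟨_, τ, by simp only [Program.bound]; omega, Runs.iteTrue b P P' σ τ t hb hr, hτ⟩
  · obtain ⟨t, τ, ht, hr, hτ⟩ := h' hb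
    exact ⟨_, τ, by simp only [Program.bound]; omega, Runs.iteFalse b P P' σ τ t hb hr, hτ⟩

/-- Repeat `P` with the register `x` running from `0` to the content of the register `y`. -/
def Program.forLoop (x y : ℕ) (P : Program) : Program :=
  .seq (.setNat x (.const 0))
    (.loop (.natLt (.reg x) (.reg y)) (.seq P (.setNat x (.add (.reg x) (.const 1)))))

theorem Halts.forLoop {x y N : ℕ} (hxy : y ≠ x) (hx : P.writesNat x = false)
    (hy : P.writesNat y = false) (I : ℕ → Store → Prop) (hσ : σ.natReg y = N) (hN : N ≤ B)
    (h0 : I 0 (σ.setNatReg x 0))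
    (step : ∀ i < N, ∀ τ, Frame (P.forLoop x y) σ τ → τ.natReg x = i → I i τ →
      Halts O B P τ fun ρ => I (i + 1) (ρ.setNatReg x (i + 1))) :
    Halts O B (P.forLoop x y) σ (I N) := by
  have hwx : (P.forLoop x y).writesNat x = true := by simp [Program.forLoop, Program.writesNat]
  have hwy : (P.forLoop x y).writesNat y = false := by
    simp [Program.forLoop, Program.writesNat, hxy, hy]
  -- Induction on the number `r` of rounds left. The extra unit in `r + 1` pays for the final
  -- failing test.
  have main : ∀ r i τ, i + r = N → Frame (P.forLoop x y) σ τ → τ.natReg x = i → I i τ →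
      ∃ t ρ, t ≤ (r + 1) * (1 + (Test.natLt (.reg x) (.reg y)).cost +
          (Program.seq P (.setNat x (.add (.reg x) (.const 1)))).bound B) ∧
        Runs O (.loop (.natLt (.reg x) (.reg y))
          (.seq P (.setNat x (.add (.reg x) (.const 1))))) τ t ρ ∧ I N ρ := by
    intro r
    induction r with
    | zero =>
      intro i τ hi hfr hx' hI
      obtain rfl : i = N := hi
      refine ⟨_, τ, ?_, Runs.loopFalse _ _ _ ?_, hI⟩
      · rw [zero_add, one_mul]; exact Nat.le_add_right _ _
      · simp only [Test.Holds, NatExpr.eval, hx', hfr.natReg y hwy, hσ, lt_irrefl,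
          not_false_eq_true]
    | succ r ih =>
      intro i τ hi hfr hx' hI
      obtain ⟨s, ρ, hs, hr, hρ⟩ := step i (by omega) τ hfr hx' hI
      have hfr' : Frame (P.forLoop x y) τ ρ := hr.frame.weaken
        (by simp +contextual [Program.forLoop, Program.writesNat])
        (by simp +contextual [Program.forLoop, Program.writesReal])
        (by simp +contextual [Program.forLoop, Program.writesNatArr])
      have hρx : ρ.natReg x = i := (hr.frame.natReg x hx).trans hx'
      obtain ⟨t, μ, ht, hr', hμ⟩ := ih (i + 1) (ρ.setNatReg x (i + 1)) (by omega)
        ((hfr.trans hfr').trans (Frame.setNatReg hwx _ _)) (by simp [Store.setNatReg]) hρ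
      have hset : Runs O (.setNat x (.add (.reg x) (.const 1))) ρ
          (1 + (NatExpr.add (.reg x) (.const 1)).cost) (ρ.setNatReg x (i + 1)) := by
        have := Runs.setNat (O := O) x (.add (.reg x) (.const 1)) ρ
        simpa only [NatExpr.eval, hρx] using this
      have hb : (Test.natLt (.reg x) (.reg y)).Holds τ := by
        simp only [Test.Holds, NatExpr.eval, hx', hfr.natReg y hwy, hσ]
        omega
      refine ⟨_, μ, ?_, Runs.loopTrue _ _ _ _ _ _ _ hb (Runs.seq _ _ _ _ _ _ _ hr hset) hr', hμ⟩
      rw [add_mul (r + 1) 1, one_mul]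
      simp only [Program.bound] at ht ⊢
      omega
  obtain ⟨t, ρ, ht, hr, hρ⟩ := main N 0 (σ.setNatReg x 0) (by omega)
    (Frame.setNatReg hwx _ _) (by simp [Store.setNatReg]) h0
  refine ⟨_, ρ, ?_, Runs.seq _ _ _ _ _ _ _ (Runs.setNat x (.const 0) σ) hr, hρ⟩
  simp only [Program.bound] at ht ⊢
  exact Nat.add_le_add_left (ht.trans (Nat.mul_le_mul_right _ (by omega))) _

/-- Two nested loops over the same range. -/
def Program.forLoop₂ (x x' y : ℕ) (P : Program) : Program := (P.forLoop x' y).forLoop x y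

/-- Two nested loops in which round `(i, j)` establishes `Goal i j` and every round preserves the
invariant and the goals already attained. -/
theorem Halts.forLoop₂ {x x' y N : ℕ} (hxy : y ≠ x) (hxy' : y ≠ x') (hxx : x ≠ x')
    (hx : P.writesNat x = false) (hx' : P.writesNat x' = false) (hy : P.writesNat y = false)
    (Inv : Store → Prop) (Goal : ℕ → ℕ → Store → Prop)
    (hInv : ∀ τ i, Inv τ → Inv (τ.setNatReg x i) ∧ Inv (τ.setNatReg x' i))
    (hGoal : ∀ τ i j l, Goal i j τ → Goal i j (τ.setNatReg x l) ∧ Goal i j (τ.setNatReg x' l))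
    (hσ : σ.natReg y = N) (hN : N ≤ B) (h0 : Inv σ)
    (step : ∀ i < N, ∀ j < N, ∀ τ, Frame (P.forLoop₂ x x' y) σ τ → τ.natReg x = i →
      τ.natReg x' = j → Inv τ → Halts O B P τ fun ρ => Inv ρ ∧ Goal i j ρ ∧
        ∀ i' < N, ∀ j' < N, Goal i' j' τ → Goal i' j' ρ) :
    Halts O B (P.forLoop₂ x x' y) σ fun ρ => Inv ρ ∧ ∀ i < N, ∀ j < N, Goal i j ρ := by
  have hwy : (P.forLoop₂ x x' y).writesNat y = false := by
    simp [Program.forLoop₂, Program.forLoop, Program.writesNat, hxy, hxy', hy]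
  refine (Halts.forLoop hxy
    (by simp [Program.forLoop, Program.writesNat, hx, hxx])
    (by simp [Program.forLoop, Program.writesNat, hy, hxy'])
    (fun i τ => Inv τ ∧ ∀ i' < i, ∀ j < N, Goal i' j τ) hσ hN
    ⟨(hInv _ _ h0).1, fun i hi => absurd hi (Nat.not_lt_zero i)⟩ ?_)
  intro i hi τ hfr hτx hI
  refine (Halts.forLoop hxy' hx' hy (N := N)
    (fun j τ => Inv τ ∧ (∀ i' < i, ∀ j < N, Goal i' j τ) ∧ ∀ j' < j, Goal i j' τ)
    ((hfr.natReg y hwy).trans hσ) hN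
    ⟨(hInv _ _ hI.1).2, fun i' hi' j hj => (hGoal _ _ _ _ (hI.2 i' hi' j hj)).2,
      fun j hj => absurd hj (Nat.not_lt_zero j)⟩ ?_).mono ?_
  · intro j hj ρ hfr' hρ hI'
    have hfr'' : Frame (P.forLoop₂ x x' y) τ ρ := hfr'.weaken
      (by simp +contextual [Program.forLoop₂, Program.forLoop, Program.writesNat])
      (by simp +contextual [Program.forLoop₂, Program.forLoop, Program.writesReal])
      (by simp +contextual [Program.forLoop₂, Program.forLoop, Program.writesNatArr])
    have hρx : ρ.natReg x = i := by
      rw [hfr'.natReg x (by simp [Program.forLoop, Program.writesNat, hx, hxx]), hτx]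
    refine (step i hi j hj ρ (hfr.trans hfr'') hρx hρ hI'.1).mono ?_
    rintro μ - ⟨h1, h2, h3⟩
    refine ⟨(hInv _ _ h1).2, fun i' hi' j' hj' => (hGoal _ _ _ _
      (h3 i' (hi'.trans hi) j' hj' (hI'.2.1 i' hi' j' hj'))).2, fun j' hj' => ?_⟩
    rcases Nat.lt_succ_iff_lt_or_eq.1 hj' with h | rfl
    · exact (hGoal _ _ _ _ (h3 i hi j' (h.trans hj) (hI'.2.2 j' h))).2
    · exact (hGoal _ _ _ _ h2).2
  · rintro ρ - ⟨h1, h2, h3⟩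
    refine ⟨(hInv _ _ h1).1, fun i' hi' j' hj' => ?_⟩
    rcases Nat.lt_succ_iff_lt_or_eq.1 hi' with h | rfl
    · exact (hGoal _ _ _ _ (h2 i' h j' hj')).1
    · exact (hGoal _ _ _ _ (h3 j' hj')).1

end Framework

end OracleMachine

/-! ### Arrays as graphs -/

namespace OracleMachine

section Graphs

variable {n : ℕ}

/-- The graph on `Fin n` that the proximity oracle reads off a square array. -/
def graphOf (n : ℕ) (A : ℕ → ℕ → ℕ) : SimpleGraph (Fin n) :=
  SimpleGraph.fromRel fun a b : Fin n => A a b ≠ 0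

theorem proximityOracle_eq (α : ℝ) (A : ℕ → ℕ → ℕ) {i j : ℕ} (hi : i < n) (hj : j < n) :
    proximityOracle n α A i j = proximity (graphOf n A) α ⟨i, hi⟩ ⟨j, hj⟩ := by
  rw [proximityOracle, dif_pos ⟨hi, hj⟩, graphOf]

/-- Overwriting one entry of an array. -/
def setEntry (A : ℕ → ℕ → ℕ) (i j v : ℕ) : ℕ → ℕ → ℕ :=
  fun i' j' => if i' = i ∧ j' = j then v else A i' j'

theorem setNatArr_natArr_self (σ : Store) (a i j v : ℕ) :
    (σ.setNatArr a i j v).natArr a = setEntry (σ.natArr a) i j v := by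
  funext i' j'
  simp [Store.setNatArr, setEntry]

theorem setEntry_self (A : ℕ → ℕ → ℕ) (i j v : ℕ) : setEntry A i j v i j = v := by
  simp [setEntry]

theorem setEntry_restore (A : ℕ → ℕ → ℕ) (i j v : ℕ) :
    setEntry (setEntry A i j v) i j (A i j) = A := by
  funext i' j'
  simp only [setEntry]
  split_ifs with h
  · rw [h.1, h.2]
  · rfl

theorem graphOf_congr {A A' : ℕ → ℕ → ℕ} (h : ∀ i < n, ∀ j < n, A i j = A' i j) :
    graphOf n A = graphOf n A' := by
  ext a b
  simp [graphOf, h a a.2 b b.2, h b b.2 a a.2]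

/-- One entry is enough because `graphOf` symmetrizes the array, and it ignores the diagonal, so `s
= t` adds nothing on either side. -/
theorem graphOf_setEntry_one (A : ℕ → ℕ → ℕ) {s t : ℕ} (hs : s < n) (ht : t < n) :
    graphOf n (setEntry A s t 1) = graphOf n A ⊔ SimpleGraph.edge ⟨s, hs⟩ ⟨t, ht⟩ := by
  ext a b
  simp only [graphOf, setEntry, SimpleGraph.fromRel_adj, SimpleGraph.sup_adj,
    SimpleGraph.edge_adj, Fin.ext_iff]
  by_cases h1 : (a : ℕ) = s ∧ (b : ℕ) = t <;> by_cases h2 : (b : ℕ) = s ∧ (a : ℕ) = t <;>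
    simp only [h1, h2, if_true, if_false, and_self] <;> tauto

end Graphs

/-! ### The program -/

/-- Copy the array `a` to the array `b`. -/
def copyArr (a b : ℕ) : Program :=
  Program.forLoop₂ 19 20 0 (.storeNat b (.reg 19) (.reg 20) (.arr a (.reg 19) (.reg 20)))

/-- Count the pairs whose proximity in array `2` is at least the content of real register `2`. -/
def countReached : Program :=
  .seq (.setNat 6 (.const 0)) (Program.forLoop 17 0 (Program.forLoop 18 0
    (.seq (.query 4 2 (.reg 17) (.reg 18))
      (.ite (.realLt (.reg 4) (.reg 2)) .skip (.setNat 6 (.add (.reg 6) (.const 1)))))))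

/-- Keep the pair in registers `15` and `16` if it is better than the best pair so far. -/
def tryPair : Program :=
  .seq (.setNat 21 (.arr 2 (.reg 15) (.reg 16)))
    (.seq (.storeNat 2 (.reg 15) (.reg 16) (.const 1))
      (.seq countReached
        (.seq (.storeNat 2 (.reg 15) (.reg 16) (.reg 21))
          (.ite (.natLt (.reg 7) (.reg 6))
            (.seq (.setNat 7 (.reg 6)) (.seq (.setNat 8 (.reg 15)) (.setNat 9 (.reg 16))))
            .skip))))

/-- Add to array `2` the edge that maximizes the number of pairs reached. -/
def greedyStep : Program :=
  .seq (.setNat 7 (.const 0)) (.seq (.setNat 8 (.const 0)) (.seq (.setNat 9 (.const 0))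
    (.seq (Program.forLoop₂ 15 16 0 tryPair) (.storeNat 2 (.reg 8) (.reg 9) (.const 1)))))

/-- Write the broadcast of array `2` to real register `5`. -/
def measureBroadcast : Program :=
  .seq (.setReal 5 (.ofNat (.const 1))) (Program.forLoop₂ 17 18 0
    (.seq (.query 4 2 (.reg 17) (.reg 18))
      (.ite (.realLt (.reg 4) (.reg 5)) (.setReal 5 (.reg 4)) .skip)))

/-- Run the greedy algorithm for one threshold and keep the result if it is the best so far. -/
def tryThreshold : Program :=
  -- Array `2` first serves to query the threshold in the graph with one extra edge, and is then
  -- reset to the input graph for the greedy run.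
  .seq (copyArr 0 2)
    (.seq (.storeNat 2 (.reg 10) (.reg 11) (.const 1))
      (.seq (.query 2 2 (.reg 12) (.reg 13))
        (.seq (copyArr 0 2)
          (.seq (Program.forLoop 14 4 greedyStep)
            (.seq measureBroadcast
              (.ite (.realLt (.reg 5) (.reg 3)) .skip
                (.seq (.setReal 3 (.reg 5)) (copyArr 2 3))))))))

/-- Compute the number of greedy steps. -/
def computeBudget : Program :=
  .seq (.ite (.natLt (.reg 1) (.reg 0)) (.setNat 2 (.reg 1)) (.setNat 2 (.reg 0)))
    (.seq (.seq (.setNat 3 (.const 0)) (.setNat 5 (.const 1)))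
      (.seq (Program.forLoop 19 0 (.ite (.natLt (.reg 5) (.reg 0))
          (.seq (.setNat 5 (.add (.reg 5) (.reg 5))) (.setNat 3 (.add (.reg 3) (.const 1)))) .skip))
        (.seq (.setNat 22 (.const 0))
          (.seq (Program.forLoop 19 2 (.setNat 22 (.add (.reg 22) (.reg 2))))
            (.seq (.setNat 4 (.const 0))
              (Program.forLoop 19 22 (.setNat 4 (.add (.reg 4)
                (.add (.add (.add (.reg 3) (.reg 3)) (.add (.reg 3) (.reg 3)))
                  (.add (.add (.reg 3) (.reg 3)) (.add (.reg 3) (.reg 3))))))))))))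

/-- Write the indicator matrix of the edges of array `3` that are not in array `0` to array `1`. -/
def writeOutput : Program :=
  Program.forLoop₂ 19 20 0
    (.ite (.and (.natLt (.arr 0 (.reg 19) (.reg 20)) (.const 1))
        (.and (.not (.and (.not (.natLt (.reg 19) (.reg 20))) (.not (.natLt (.reg 20) (.reg 19)))))
          (.not (.and (.natLt (.arr 3 (.reg 19) (.reg 20)) (.const 1))
            (.natLt (.arr 3 (.reg 20) (.reg 19)) (.const 1))))))
      (.storeNat 1 (.reg 19) (.reg 20) (.const 1)) (.storeNat 1 (.reg 19) (.reg 20) (.const 0)))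

/-- The algorithm: greedy covering for all thresholds. -/
def greedyBroadcast : Program :=
  .seq computeBudget (.seq (copyArr 0 3) (.seq
    (Program.forLoop₂ 10 11 0 (Program.forLoop₂ 12 13 0 tryThreshold)) writeOutput))

/-! ### Correctness of the subroutines -/

section Correctness

variable {n B : ℕ} {α : ℝ}

theorem halts_copyArr {O : (ℕ → ℕ → ℕ) → ℕ → ℕ → ℝ} {a b : ℕ} (hab : a ≠ b) {σ : Store}
    (h0 : σ.natReg 0 = n) (hB : n ≤ B) :
    Halts O B (copyArr a b) σ fun τ => ∀ i < n, ∀ j < n, τ.natArr b i j = σ.natArr a i j := by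
  refine Halts.mono (Halts.forLoop₂ (by decide) (by decide) (by decide) rfl rfl rfl (fun _ => True)
    (fun i j τ => τ.natArr b i j = σ.natArr a i j) (fun _ _ h => ⟨h, h⟩) (fun _ _ _ _ h => ⟨h, h⟩)
    h0 hB trivial ?_) fun τ _ h => h.2
  intro i hi j hj τ hfr h19 h20 _
  have ha : τ.natArr a = σ.natArr a := hfr.natArr a (by
    simp [Program.forLoop₂, Program.forLoop, Program.writesNatArr, hab])
  refine Halts.storeNat ?_
  simp only [NatExpr.eval, h19, h20, ha, setNatArr_natArr_self, setEntry_self, true_and]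
  intro i' _ j' _ h
  simp only [setEntry]
  split_ifs with hc
  · rw [hc.1, hc.2]
  · exact h

theorem numReached_graphOf (A : ℕ → ℕ → ℕ) (α c : ℝ) :
    numReached (graphOf n A) α c = ∑ i ∈ Finset.range n, ∑ j ∈ Finset.range n,
      if proximityOracle n α A i j < c then 0 else 1 := by
  classical
  rw [numReached, Finset.card_filter, ← Finset.univ_product_univ, Finset.sum_product,
    Finset.sum_range]
  refine Finset.sum_congr rfl fun i _ => ?_
  rw [Finset.sum_range]
  refine Finset.sum_congr rfl fun j _ => ?_
  rw [proximityOracle_eq α A i.2 j.2]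
  by_cases h : c ≤ proximity (graphOf n A) α i j
  · rw [if_pos h, if_neg (not_lt.2 h)]
  · rw [if_neg h, if_pos (not_le.1 h)]

theorem halts_countReached {σ : Store} (h0 : σ.natReg 0 = n) (hB : n ≤ B) :
    Halts (proximityOracle n α) B countReached σ fun τ =>
      τ.natReg 6 = numReached (graphOf n (σ.natArr 2)) α (σ.realReg 2) := by
  rw [numReached_graphOf]
  set f : ℕ → ℕ → ℕ := fun i j =>
    if proximityOracle n α (σ.natArr 2) i j < σ.realReg 2 then 0 else 1 with hf
  refine Halts.seq (Halts.setNat ?_)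
  refine Halts.forLoop (by decide) rfl rfl
    (fun i τ => τ.natReg 6 = ∑ i' ∈ Finset.range i, ∑ j ∈ Finset.range n, f i' j) h0 hB rfl ?_
  intro i hi τ hfr h17 hI
  refine Halts.mono (Halts.forLoop (N := n) (by decide) rfl rfl (fun j τ => τ.natReg 6 =
    (∑ i' ∈ Finset.range i, ∑ j ∈ Finset.range n, f i' j) + ∑ j' ∈ Finset.range j, f i j')
    ((hfr.natReg 0 rfl).trans h0) hB (by simpa [Store.setNatReg] using hI) ?_) ?_
  · intro j hj ρ hfr' h18 hJ
    have hρ17 : ρ.natReg 17 = i := (hfr'.natReg 17 rfl).trans h17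
    have hA : ρ.natArr 2 = σ.natArr 2 := (hfr'.natArr 2 rfl).trans (hfr.natArr 2 rfl)
    have hc : ρ.realReg 2 = σ.realReg 2 := (hfr'.realReg 2 rfl).trans (hfr.realReg 2 rfl)
    refine Halts.seq (Halts.query (Halts.ite (fun hlt => Halts.skip ?_)
      fun hlt => Halts.setNat ?_)) <;>
    · simp [Test.Holds, RealExpr.eval, NatExpr.eval, Store.setRealReg, h18, hρ17, hA, hc] at hlt
      simp [Store.setNatReg, Store.setRealReg, NatExpr.eval, hJ, Finset.sum_range_succ, hf, hlt,
        add_assoc]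
  · intro ρ _ h
    rw [Finset.sum_range_succ]
    exact h

theorem halts_greedyStep (hn : 0 < n) {σ : Store} (h0 : σ.natReg 0 = n) (hB : n ≤ B) :
    Halts (proximityOracle n α) B greedyStep σ fun τ => ∃ s t : Fin n,
      graphOf n (τ.natArr 2) = graphOf n (σ.natArr 2) ⊔ SimpleGraph.edge s t ∧
      ∀ s' t' : Fin n,
        numReached (graphOf n (σ.natArr 2) ⊔ SimpleGraph.edge s' t') α (σ.realReg 2) ≤
          numReached (graphOf n (σ.natArr 2) ⊔ SimpleGraph.edge s t) α (σ.realReg 2) := by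
  set A := σ.natArr 2 with hA
  set c := σ.realReg 2 with hc
  refine Halts.seq (Halts.setNat (Halts.seq (Halts.setNat (Halts.seq (Halts.setNat
    (Halts.seq ?_))))))
  -- The record in register `7` is only required to be at most the count of the recorded pair, so
  -- the initial record `0` with the pair `(0, 0)` qualifies. Together with the goals this makes the
  -- final pair a maximizer.
  refine Halts.mono (Halts.forLoop₂ (N := n) (by decide) (by decide) (by decide) rfl rfl rfl
    (fun τ => τ.natArr 2 = A ∧ τ.natReg 8 < n ∧ τ.natReg 9 < n ∧
      τ.natReg 7 ≤ numReached (graphOf n (setEntry A (τ.natReg 8) (τ.natReg 9) 1)) α c)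
    (fun s t τ => numReached (graphOf n (setEntry A s t 1)) α c ≤ τ.natReg 7)
    (fun _ _ h => ⟨h, h⟩) (fun _ _ _ _ h => ⟨h, h⟩) h0 hB ⟨rfl, hn, hn, Nat.zero_le _⟩ ?_) ?_
  · intro s hs t ht τ hfr h15 h16 hI
    have hτ0 : τ.natReg 0 = n := (hfr.natReg 0 rfl).trans h0
    have hτc : τ.realReg 2 = c := hfr.realReg 2 rfl
    refine Halts.seq (Halts.setNat (Halts.seq (Halts.storeNat (Halts.seq ?_))))
    refine Halts.mono (halts_countReached (n := n) hτ0 hB) ?_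
    intro ρ hfr' h6
    rw [setNatArr_natArr_self] at h6
    have e2 : ρ.natArr 2 = setEntry A s t 1 := by
      rw [hfr'.natArr 2 rfl, setNatArr_natArr_self]
      simp [NatExpr.eval, Store.setNatReg, h15, h16, hI.1]
    have e6 : ρ.natReg 6 = numReached (graphOf n (setEntry A s t 1)) α c := by
      rw [h6]
      simp [NatExpr.eval, Store.setNatReg, Store.setNatArr, h15, h16, hI.1, hτc]
    have e15 : ρ.natReg 15 = s := (hfr'.natReg 15 rfl).trans h15
    have e16 : ρ.natReg 16 = t := (hfr'.natReg 16 rfl).trans h16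
    have e21 : ρ.natReg 21 = A s t := by
      rw [hfr'.natReg 21 rfl]
      simp [NatExpr.eval, Store.setNatReg, Store.setNatArr, h15, h16, hI.1]
    have e7 : ρ.natReg 7 = τ.natReg 7 := hfr'.natReg 7 rfl
    have e8 : ρ.natReg 8 = τ.natReg 8 := hfr'.natReg 8 rfl
    have e9 : ρ.natReg 9 = τ.natReg 9 := hfr'.natReg 9 rfl
    refine Halts.seq (Halts.storeNat ?_)
    simp only [NatExpr.eval, e15, e16, e21]
    -- Putting the saved entry back makes every candidate edge tested against the same graph.
    have eA : (ρ.setNatArr 2 s t (A s t)).natArr 2 = A := by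
      rw [setNatArr_natArr_self, e2, setEntry_restore]
    refine Halts.ite (fun hlt => Halts.seq (Halts.setNat (Halts.seq (Halts.setNat
      (Halts.setNat ?_))))) (fun hlt => Halts.skip ?_)
    · have hlt : τ.natReg 7 < numReached (graphOf n (setEntry A s t 1)) α c := by
        rw [← e6, ← e7]; exact hlt
      refine ⟨⟨eA, ?_, ?_, ?_⟩, ?_, ?_⟩ <;>
        simp only [NatExpr.eval, Store.setNatReg, Store.setNatArr, Function.update_self, e15, e16,
          e6, ne_eq, Nat.reduceEqDiff, not_false_eq_true,
          Function.update_of_ne, hs, ht, le_refl]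
      exact fun i' _ j' _ h => h.trans hlt.le
    · have hlt : ¬ τ.natReg 7 < numReached (graphOf n (setEntry A s t 1)) α c := by
        rw [← e6, ← e7]; exact hlt
      have e7' : (ρ.setNatArr 2 s t (A s t)).natReg 7 = τ.natReg 7 := e7
      have e8' : (ρ.setNatArr 2 s t (A s t)).natReg 8 = τ.natReg 8 := e8
      have e9' : (ρ.setNatArr 2 s t (A s t)).natReg 9 = τ.natReg 9 := e9
      rw [e7', e8', e9', eA]
      exact ⟨⟨rfl, hI.2⟩, not_lt.1 hlt, fun _ _ _ _ h => h⟩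
  · rintro τ hfr ⟨⟨hA', h8, h9, h7⟩, hG⟩
    refine Halts.storeNat ⟨⟨_, h8⟩, ⟨_, h9⟩, ?_, fun s' t' => ?_⟩
    · rw [setNatArr_natArr_self, hA']
      exact graphOf_setEntry_one A h8 h9
    · rw [← graphOf_setEntry_one A h8 h9, ← graphOf_setEntry_one A s'.2 t'.2]
      exact (hG s' s'.2 t' t'.2).trans h7

theorem halts_measureBroadcast (hn : 0 < n) {σ : Store} (h0 : σ.natReg 0 = n) (hB : n ≤ B) :
    Halts (proximityOracle n α) B measureBroadcast σ fun τ =>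
      (∀ u v : Fin n, τ.realReg 5 ≤ proximity (graphOf n (σ.natArr 2)) α u v) ∧
      ∀ c : ℝ, (∀ u v : Fin n, c ≤ proximity (graphOf n (σ.natArr 2)) α u v) →
        c ≤ τ.realReg 5 := by
  set A := σ.natArr 2 with hA
  refine Halts.seq (Halts.setReal ?_)
  refine Halts.mono (Halts.forLoop₂ (N := n) (by decide) (by decide) (by decide) rfl rfl rfl
    (fun τ => ∀ c : ℝ, (∀ u v : Fin n, c ≤ proximity (graphOf n A) α u v) → c ≤ τ.realReg 5)
    (fun u v τ => τ.realReg 5 ≤ proximityOracle n α A u v)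
    (fun _ _ h => ⟨h, h⟩) (fun _ _ _ _ h => ⟨h, h⟩) h0 hB ?_ ?_) ?_
  -- The initial value `1` is harmless: it is the proximity of a vertex to itself.
  · intro c hc
    have := hc ⟨0, hn⟩ ⟨0, hn⟩
    rw [proximity_self] at this
    simpa [Store.setRealReg, RealExpr.eval, NatExpr.eval] using this
  · intro u hu v hv τ hfr h17 h18 hI
    have hτ2 : τ.natArr 2 = A := hfr.natArr 2 rfl
    refine Halts.seq (Halts.query (Halts.ite (fun hlt => Halts.setReal ?_)
      fun hlt => Halts.skip ?_)) <;>
      simp [Test.Holds, RealExpr.eval, NatExpr.eval, Store.setRealReg, h17, h18, hτ2] at hlt ⊢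
    · refine ⟨fun c hc => ?_, fun _ _ _ _ h => hlt.le.trans h⟩
      rw [proximityOracle_eq α A hu hv]
      exact hc _ _
    · exact ⟨hI, hlt⟩
  · rintro τ - ⟨h1, h2⟩
    refine ⟨fun u v => ?_, h1⟩
    have := h2 u u.2 v v.2
    rwa [proximityOracle_eq α A u.2 v.2] at this

end Correctness

end OracleMachine

/-! ### Correctness of the whole program -/

namespace OracleMachine

section Main

variable {n B : ℕ} {α : ℝ}

/-- Array `3` holds `G` with at most `M` additional edges, and real register `3` is a lower bound
for its broadcast. -/
def BestSoFar (G : SimpleGraph (Fin n)) (α : ℝ) (M : ℕ) (σ : Store) : Prop :=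
  (∃ F : Finset (Sym2 (Fin n)), F.card ≤ M ∧ graphOf n (σ.natArr 3) = addEdges G F) ∧
    ∀ u v : Fin n, σ.realReg 3 ≤ proximity (graphOf n (σ.natArr 3)) α u v

/-- Real register `3` is at least the broadcast of some greedy augmentation for threshold `c`. -/
def Tried (G : SimpleGraph (Fin n)) (α : ℝ) (M : ℕ) (c : ℝ) (σ : Store) : Prop :=
  ∃ K, GreedyReach G α c M K ∧
    ∀ b : ℝ, (∀ u v : Fin n, b ≤ proximity K α u v) → b ≤ σ.realReg 3

theorem Tried.mono {G : SimpleGraph (Fin n)} {M : ℕ} {c : ℝ} {σ τ : Store}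
    (h : Tried G α M c σ) (hle : σ.realReg 3 ≤ τ.realReg 3) : Tried G α M c τ := by
  obtain ⟨K, hK, hb⟩ := h
  exact ⟨K, hK, fun b hb' => (hb b hb').trans hle⟩

theorem halts_tryThreshold {M s t u v : ℕ} (hs : s < n) (ht : t < n) (hu : u < n) (hv : v < n)
    {σ : Store} (h0 : σ.natReg 0 = n) (h4 : σ.natReg 4 = M) (h10 : σ.natReg 10 = s)
    (h11 : σ.natReg 11 = t) (h12 : σ.natReg 12 = u) (h13 : σ.natReg 13 = v) (hB : n ≤ B)
    (hMB : M ≤ B) (hbest : BestSoFar (graphOf n (σ.natArr 0)) α M σ) :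
    Halts (proximityOracle n α) B tryThreshold σ fun τ =>
      BestSoFar (graphOf n (σ.natArr 0)) α M τ ∧ σ.realReg 3 ≤ τ.realReg 3 ∧
      Tried (graphOf n (σ.natArr 0)) α M
        (proximityOracle n α (setEntry (σ.natArr 0) s t 1) u v) τ := by
  set A := σ.natArr 0 with hA
  set c := proximityOracle n α (setEntry A s t 1) u v with hc
  refine Halts.seq (Halts.mono (halts_copyArr (by decide) h0 hB) ?_)
  intro τ hfr hcopy
  have hτ10 : τ.natReg 10 = s := (hfr.natReg 10 rfl).trans h10
  have hτ11 : τ.natReg 11 = t := (hfr.natReg 11 rfl).trans h11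
  have hτ12 : τ.natReg 12 = u := (hfr.natReg 12 rfl).trans h12
  have hτ13 : τ.natReg 13 = v := (hfr.natReg 13 rfl).trans h13
  have hcopy' : ∀ i < n, ∀ j < n, τ.natArr 2 i j = A i j := hcopy
  refine Halts.seq (Halts.storeNat (Halts.seq (Halts.query (Halts.seq ?_))))
  simp only [NatExpr.eval, hτ10, hτ11, setNatArr_natArr_self]
  -- The copy agrees with `A` only on indices below `n`, so the two oracle answers are compared
  -- through the graphs.
  have hq : proximityOracle n α (setEntry (τ.natArr 2) s t 1)
      ((τ.setNatArr 2 s t 1).natReg 12) ((τ.setNatArr 2 s t 1).natReg 13) = c := by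
    have e12 : (τ.setNatArr 2 s t 1).natReg 12 = u := hτ12
    have e13 : (τ.setNatArr 2 s t 1).natReg 13 = v := hτ13
    rw [e12, e13, hc, proximityOracle_eq α _ hu hv, proximityOracle_eq α _ hu hv,
      graphOf_setEntry_one _ hs ht, graphOf_setEntry_one _ hs ht, graphOf_congr hcopy']
  rw [hq]
  have hτ0 : ((τ.setNatArr 2 s t 1).setRealReg 2 c).natReg 0 = n := (hfr.natReg 0 rfl).trans h0
  have hμA : ((τ.setNatArr 2 s t 1).setRealReg 2 c).natArr 0 = A := by
    have : ((τ.setNatArr 2 s t 1).setRealReg 2 c).natArr 0 = τ.natArr 0 := by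
      funext i j
      simp [Store.setRealReg, Store.setNatArr]
    rw [this, hfr.natArr 0 rfl]
  have hμ3 : ((τ.setNatArr 2 s t 1).setRealReg 2 c).natArr 3 = σ.natArr 3 := by
    have : ((τ.setNatArr 2 s t 1).setRealReg 2 c).natArr 3 = τ.natArr 3 := by
      funext i j
      simp [Store.setRealReg, Store.setNatArr]
    rw [this, hfr.natArr 3 rfl]
  have hμc : ((τ.setNatArr 2 s t 1).setRealReg 2 c).realReg 2 = c := by simp [Store.setRealReg]
  have hμb : ((τ.setNatArr 2 s t 1).setRealReg 2 c).realReg 3 = σ.realReg 3 :=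
    hfr.realReg 3 rfl
  have hμ4 : ((τ.setNatArr 2 s t 1).setRealReg 2 c).natReg 4 = M := (hfr.natReg 4 rfl).trans h4
  generalize (τ.setNatArr 2 s t 1).setRealReg 2 c = μ at hτ0 hμA hμ3 hμc hμb hμ4 ⊢
  refine Halts.mono (halts_copyArr (by decide) hτ0 hB) ?_
  intro ν hfr2 hcopy2
  rw [hμA] at hcopy2
  have hν0 : ν.natReg 0 = n := (hfr2.natReg 0 rfl).trans hτ0
  have hν4 : ν.natReg 4 = M := (hfr2.natReg 4 rfl).trans hμ4
  have hνc : ν.realReg 2 = c := (hfr2.realReg 2 rfl).trans hμc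
  have hνb : ν.realReg 3 = σ.realReg 3 := (hfr2.realReg 3 rfl).trans hμb
  have hν3 : ν.natArr 3 = σ.natArr 3 := (hfr2.natArr 3 rfl).trans hμ3
  refine Halts.seq (Halts.mono (Halts.forLoop (by decide) rfl rfl
    (fun i τ => GreedyReach (graphOf n A) α c i (graphOf n (τ.natArr 2))) hν4 hMB ?_ ?_) ?_)
  · have : graphOf n (ν.natArr 2) = graphOf n A := graphOf_congr hcopy2
    show GreedyReach (graphOf n A) α c 0 (graphOf n (ν.natArr 2))
    rw [this]
    exact GreedyReach.zero
  · intro i _ ρ hfr3 _ hI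
    refine Halts.mono (halts_greedyStep (n := n) (by omega) ((hfr3.natReg 0 rfl).trans hν0) hB) ?_
    rintro κ - ⟨s', t', hκ, hmax⟩
    show GreedyReach (graphOf n A) α c (i + 1) (graphOf n (κ.natArr 2))
    rw [(hfr3.realReg 2 rfl).trans hνc] at hmax
    rw [hκ]
    exact GreedyReach.step i _ s' t' hI hmax
  · intro ρ hfr3 hreach
    have hρ0 : ρ.natReg 0 = n := (hfr3.natReg 0 rfl).trans hν0
    refine Halts.seq (Halts.mono (halts_measureBroadcast (n := n) (by omega) hρ0 hB) ?_)
    intro κ hfr4 hκ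
    have hκ0 : κ.natReg 0 = n := (hfr4.natReg 0 rfl).trans hρ0
    have hκ2 : κ.natArr 2 = ρ.natArr 2 := hfr4.natArr 2 rfl
    have hκb : κ.realReg 3 = σ.realReg 3 :=
      ((hfr4.realReg 3 rfl).trans (hfr3.realReg 3 rfl)).trans hνb
    have hκ3 : κ.natArr 3 = σ.natArr 3 :=
      ((hfr4.natArr 3 rfl).trans (hfr3.natArr 3 rfl)).trans hν3
    refine Halts.ite (fun hlt => Halts.skip ?_) fun hlt => Halts.seq (Halts.setReal ?_)
    · have hlt : κ.realReg 5 < κ.realReg 3 := hlt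
      refine ⟨?_, hκb.ge, _, hreach, fun b hb => (hκ.2 b hb).trans hlt.le⟩
      rw [BestSoFar, hκ3, hκb]
      exact hbest
    · have hlt : ¬ κ.realReg 5 < κ.realReg 3 := hlt
      have e2 : (κ.setRealReg 3 (κ.realReg 5)).natArr 2 = ρ.natArr 2 := hκ2
      simp only [RealExpr.eval]
      refine Halts.mono (halts_copyArr (n := n) (by decide) hκ0 hB) ?_
      intro ξ hfr5 hcopy5
      rw [e2] at hcopy5
      have hξ3 : graphOf n (ξ.natArr 3) = graphOf n (ρ.natArr 2) := graphOf_congr hcopy5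
      have hξb : ξ.realReg 3 = κ.realReg 5 := by
        rw [hfr5.realReg 3 rfl]
        simp [Store.setRealReg]
      refine ⟨?_, ?_, _, hreach, fun b hb => ?_⟩
      · rw [BestSoFar, hξ3, hξb]
        exact ⟨hreach.exists_addEdges, hκ.1⟩
      · rw [hξb, ← hκb]
        exact not_lt.1 hlt
      · rw [hξb]
        exact hκ.2 b hb

/-- Lacking multiplication, the machine finds the logarithm by doubling and the products by repeated
addition. Every loop length is bounded through `n`, never through `k` alone. -/
theorem halts_computeBudget {O : (ℕ → ℕ → ℕ) → ℕ → ℕ → ℝ} {k : ℕ} {σ : Store}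
    (h0 : σ.natReg 0 = n) (h1 : σ.natReg 1 = k) (hB : n ≤ B) (hB2 : min k n ^ 2 ≤ B) :
    Halts O B computeBudget σ fun τ => τ.natReg 4 = 2 * (4 * min k n ^ 2) * Nat.clog 2 n := by
  have hkB : min k n ≤ B := (min_le_right k n).trans hB
  refine Halts.seq ?_
  have hmin : Halts O B (.ite (.natLt (.reg 1) (.reg 0)) (.setNat 2 (.reg 1)) (.setNat 2 (.reg 0)))
      σ fun τ => τ.natReg 2 = min k n := by
    refine Halts.ite (fun h => Halts.setNat ?_) fun h => Halts.setNat ?_ <;>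
      simp only [Test.Holds, NatExpr.eval, h0, h1, Store.setNatReg, Function.update_self] at h ⊢ <;>
      omega
  refine hmin.mono ?_
  intro τ hfr h2
  have hτ0 : τ.natReg 0 = n := (hfr.natReg 0 rfl).trans h0
  refine Halts.seq (Halts.seq (Halts.setNat (Halts.setNat (Halts.seq ?_))))
  -- Doubling stops at the first power of two that is at least `n`; `n` rounds suffice since
  -- `Nat.clog 2 n ≤ n`.
  refine Halts.mono (Halts.forLoop (by decide) rfl rfl
    (fun i τ => τ.natReg 3 = min i (Nat.clog 2 n) ∧ τ.natReg 5 = 2 ^ min i (Nat.clog 2 n))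
    hτ0 hB ?_ ?_) ?_
  · simp [Store.setNatReg, NatExpr.eval]
  · intro i _ ρ hfr' _ ⟨h3, h5⟩
    have hρ0 : ρ.natReg 0 = n := (hfr'.natReg 0 rfl).trans hτ0
    refine Halts.ite (fun h => Halts.seq (Halts.setNat (Halts.setNat ?_)))
      fun h => Halts.skip ?_
    · simp only [Test.Holds, NatExpr.eval, hρ0, h5] at h
      have h' := (Nat.lt_clog_iff_pow_lt one_lt_two).2 h
      have e1 : min i (Nat.clog 2 n) = i := by omega
      have e2 : min (i + 1) (Nat.clog 2 n) = i + 1 := by omega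
      rw [e1] at h3 h5
      rw [e2]
      simp [Store.setNatReg, NatExpr.eval, h3, h5, pow_succ, mul_two]
    · simp only [Test.Holds, NatExpr.eval, hρ0, h5] at h
      have h' : ¬ _ := fun hh => h ((Nat.lt_clog_iff_pow_lt one_lt_two).1 hh)
      have e1 : min i (Nat.clog 2 n) = Nat.clog 2 n := by omega
      have e2 : min (i + 1) (Nat.clog 2 n) = Nat.clog 2 n := by omega
      rw [e1] at h3 h5
      rw [e2]
      exact ⟨h3, h5⟩
  intro ρ hfr' ⟨h3, _⟩
  have hclog : Nat.clog 2 n ≤ n := Nat.clog_le_of_le_pow Nat.lt_two_pow_self.le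
  rw [min_eq_right hclog] at h3
  have hρ2 : ρ.natReg 2 = min k n := (hfr'.natReg 2 rfl).trans h2
  refine Halts.seq (Halts.setNat (Halts.seq (Halts.mono (Halts.forLoop (by decide) rfl rfl
    (fun i τ => τ.natReg 22 = i * min k n) hρ2 hkB ?_ ?_) ?_)))
  · simp [Store.setNatReg, NatExpr.eval]
  · intro i _ κ hfr2 _ hI
    have hκ2 : κ.natReg 2 = min k n := (hfr2.natReg 2 rfl).trans hρ2
    refine Halts.setNat ?_
    simp [Store.setNatReg, NatExpr.eval, hI, hκ2, add_mul]
  intro κ hfr2 h22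
  have hκ3 : κ.natReg 3 = Nat.clog 2 n := (hfr2.natReg 3 rfl).trans h3
  rw [← sq] at h22
  refine Halts.seq (Halts.setNat (Halts.mono (Halts.forLoop (by decide) rfl rfl
    (fun i τ => τ.natReg 4 = i * (8 * Nat.clog 2 n)) h22 hB2 ?_ ?_) ?_))
  · simp [Store.setNatReg, NatExpr.eval]
  · intro i _ ξ hfr3 _ hI
    have hξ3 : ξ.natReg 3 = Nat.clog 2 n := (hfr3.natReg 3 rfl).trans hκ3
    refine Halts.setNat ?_
    simp [Store.setNatReg, NatExpr.eval, hI, hξ3, add_mul]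
    ring
  · intro ξ _ h
    rw [h]
    ring

theorem halts_writeOutput {O : (ℕ → ℕ → ℕ) → ℕ → ℕ → ℝ} {σ : Store} (h0 : σ.natReg 0 = n)
    (hB : n ≤ B) :
    Halts O B writeOutput σ fun τ => ∀ i < n, ∀ j < n, τ.natArr 1 i j =
      if σ.natArr 0 i j = 0 ∧ i ≠ j ∧ (σ.natArr 3 i j ≠ 0 ∨ σ.natArr 3 j i ≠ 0) then 1 else 0 := by
  refine Halts.mono (Halts.forLoop₂ (by decide) (by decide) (by decide) rfl rfl rfl
    (fun _ => True) (fun i j τ => τ.natArr 1 i j =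
      if σ.natArr 0 i j = 0 ∧ i ≠ j ∧ (σ.natArr 3 i j ≠ 0 ∨ σ.natArr 3 j i ≠ 0) then 1 else 0)
    (fun _ _ h => ⟨h, h⟩) (fun _ _ _ _ h => ⟨h, h⟩) h0 hB trivial ?_) fun τ _ h => h.2
  intro i hi j hj τ hfr h19 h20 _
  have hA0 : τ.natArr 0 = σ.natArr 0 := hfr.natArr 0 rfl
  have hA3 : τ.natArr 3 = σ.natArr 3 := hfr.natArr 3 rfl
  refine Halts.ite (fun h => Halts.storeNat ?_) fun h => Halts.storeNat ?_
  all_goals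
    simp only [Test.Holds, NatExpr.eval, h19, h20, hA0, hA3, Nat.lt_one_iff] at h
    simp only [NatExpr.eval, h19, h20, setNatArr_natArr_self, setEntry_self, true_and]
    have key : ∀ b : ℕ, (b = if σ.natArr 0 i j = 0 ∧ i ≠ j ∧
        (σ.natArr 3 i j ≠ 0 ∨ σ.natArr 3 j i ≠ 0) then 1 else 0) →
        b = (if σ.natArr 0 i j = 0 ∧ i ≠ j ∧
          (σ.natArr 3 i j ≠ 0 ∨ σ.natArr 3 j i ≠ 0) then 1 else 0) ∧
        ∀ i' < n, ∀ j' < n, (τ.natArr 1 i' j' = if σ.natArr 0 i' j' = 0 ∧ i' ≠ j' ∧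
          (σ.natArr 3 i' j' ≠ 0 ∨ σ.natArr 3 j' i' ≠ 0) then 1 else 0) →
          setEntry (τ.natArr 1) i j b i' j' = if σ.natArr 0 i' j' = 0 ∧ i' ≠ j' ∧
          (σ.natArr 3 i' j' ≠ 0 ∨ σ.natArr 3 j' i' ≠ 0) then 1 else 0 := by
      intro b hb
      refine ⟨hb, fun i' _ j' _ h' => ?_⟩
      by_cases hc : i' = i ∧ j' = j
      · rw [hc.1, hc.2, setEntry_self, hb]
      · rw [← h', setEntry, if_neg hc]
    apply key
  · rw [if_pos]
    refine ⟨h.1, by omega, ?_⟩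
    by_contra hc
    push Not at hc
    exact h.2.2 hc
  · rw [if_neg]
    rintro ⟨h1, h2, h3⟩
    refine h ⟨h1, by omega, ?_⟩
    rintro ⟨h4, h5⟩
    rcases h3 with h3 | h3 <;> contradiction

open Classical in
theorem halts_greedyBroadcast {G : SimpleGraph (Fin n)} {k M : ℕ} (hα : 0 ≤ α) (hα1 : α ≤ 1)
    {σ : Store} (h0 : σ.natReg 0 = n) (h1 : σ.natReg 1 = k) (hr3 : σ.realReg 3 = 0)
    (hG : graphOf n (σ.natArr 0) = G) (hM : M = 2 * (4 * min k n ^ 2) * Nat.clog 2 n)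
    (hB : n ≤ B) (hB2 : min k n ^ 2 ≤ B) (hMB : M ≤ B) :
    Halts (proximityOracle n α) B greedyBroadcast σ fun τ =>
      ∃ F : Finset (Sym2 (Fin n)), F.card ≤ M ∧
        (∀ i j : Fin n, τ.natArr 1 i j =
          if σ.natArr 0 i j = 0 ∧ i ≠ j ∧ (addEdges G F).Adj i j then 1 else 0) ∧
        ∀ s t u v : Fin n, ∃ K,
          GreedyReach G α (proximity (G ⊔ SimpleGraph.edge s t) α u v) M K ∧
          ∀ b : ℝ, (∀ u v : Fin n, b ≤ proximity K α u v) →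
            ∀ u v : Fin n, b ≤ proximity (addEdges G F) α u v := by
  refine Halts.seq (Halts.mono (halts_computeBudget h0 h1 hB hB2) ?_)
  rw [← hM]
  intro τ hfr h4
  have hτ0 : τ.natReg 0 = n := (hfr.natReg 0 rfl).trans h0
  have hτA : τ.natArr 0 = σ.natArr 0 := hfr.natArr 0 rfl
  refine Halts.seq (Halts.mono (halts_copyArr (by decide) hτ0 hB) ?_)
  intro ρ hfr1 hcopy
  have hρ0 : ρ.natReg 0 = n := (hfr1.natReg 0 rfl).trans hτ0
  have hρ4 : ρ.natReg 4 = M := (hfr1.natReg 4 rfl).trans h4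
  have hρA : ρ.natArr 0 = σ.natArr 0 := (hfr1.natArr 0 rfl).trans hτA
  have hρG : graphOf n (ρ.natArr 0) = G := by rw [hρA, hG]
  have hρ3 : graphOf n (ρ.natArr 3) = G := by
    rw [graphOf_congr hcopy, hτA, hG]
  have hρr : ρ.realReg 3 = 0 :=
    ((hfr1.realReg 3 rfl).trans (hfr.realReg 3 rfl)).trans hr3
  have hbest : BestSoFar G α M ρ := by
    refine ⟨⟨∅, by simp, by simp [hρ3, addEdges]⟩, fun u v => ?_⟩
    rw [hρr]
    exact proximity_nonneg hα hα1 _ _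
  refine Halts.seq (Halts.mono (Halts.forLoop₂ (N := n) (by decide) (by decide) (by decide)
    rfl rfl rfl (fun τ => BestSoFar G α M τ)
    (fun s t τ => ∀ u < n, ∀ v < n,
      Tried G α M (proximityOracle n α (setEntry (σ.natArr 0) s t 1) u v) τ)
    (fun _ _ h => ⟨h, h⟩) (fun _ _ _ _ h => ⟨h, h⟩) hρ0 hB hbest ?_) ?_)
  · intro s hs t ht κ hfr2 h10 h11 hI
    have hκ0 : κ.natReg 0 = n := (hfr2.natReg 0 rfl).trans hρ0
    -- The inner invariant also records that real register `3` has not dropped, which preserves the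
    -- goals of earlier outer rounds.
    refine Halts.mono (Halts.forLoop₂ (N := n) (by decide) (by decide) (by decide)
      rfl rfl rfl (fun τ => BestSoFar G α M τ ∧ κ.realReg 3 ≤ τ.realReg 3)
      (fun u v τ => Tried G α M (proximityOracle n α (setEntry (σ.natArr 0) s t 1) u v) τ)
      (fun _ _ h => ⟨h, h⟩) (fun _ _ _ _ h => ⟨h, h⟩) hκ0 hB ⟨hI, le_rfl⟩ ?_) ?_
    · intro u hu v hv ξ hfr3 h12 h13 hJ
      have hξA : ξ.natArr 0 = σ.natArr 0 :=
        ((hfr3.natArr 0 rfl).trans (hfr2.natArr 0 rfl)).trans hρA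
      have hξG : graphOf n (ξ.natArr 0) = G := by rw [hξA, hG]
      refine Halts.mono (halts_tryThreshold (M := M) hs ht hu hv
        ((hfr3.natReg 0 rfl).trans hκ0)
        (((hfr3.natReg 4 rfl).trans (hfr2.natReg 4 rfl)).trans hρ4)
        ((hfr3.natReg 10 rfl).trans h10) ((hfr3.natReg 11 rfl).trans h11) h12 h13 hB hMB
        (by rw [hξG]; exact hJ.1)) ?_
      rw [hξG, hξA]
      rintro ζ - ⟨h5, h6, h7⟩
      exact ⟨⟨h5, hJ.2.trans h6⟩, h7, fun _ _ _ _ h => h.mono h6⟩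
    · rintro ξ - ⟨⟨h5, h6⟩, h7⟩
      exact ⟨h5, h7, fun _ _ _ _ h u hu v hv => (h u hu v hv).mono h6⟩
  · rintro κ hfr2 ⟨⟨⟨F, hFc, hF⟩, hb⟩, hgoal⟩
    have hκ0 : κ.natReg 0 = n := (hfr2.natReg 0 rfl).trans hρ0
    have hκA : κ.natArr 0 = σ.natArr 0 := (hfr2.natArr 0 rfl).trans hρA
    refine Halts.mono (halts_writeOutput hκ0 hB) ?_
    intro ξ _ hout
    refine ⟨F, hFc, fun i j => ?_, fun s t u v => ?_⟩
    · rw [hout i i.2 j j.2, hκA, ← hF]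
      refine if_congr ?_ rfl rfl
      simp only [graphOf, SimpleGraph.fromRel_adj, ne_eq, Fin.ext_iff]
      tauto
    · obtain ⟨K, hK, hKb⟩ := hgoal s s.2 t t.2 u u.2 v v.2
      rw [proximityOracle_eq α _ u.2 v.2, graphOf_setEntry_one _ s.2 t.2, hG] at hK
      exact ⟨K, hK, fun b hb' u' v' => (hKb b hb').trans (by rw [← hF]; exact hb u' v')⟩

end Main

end OracleMachine

/-! ### From covering to the approximation ratios -/

section Approximation

open OracleMachine

theorem graphOf_inputStore {n : ℕ} (G : SimpleGraph (Fin n)) (k : ℕ) (α ε : ℝ) :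
    graphOf n ((inputStore n G k α ε).natArr 0) = G := by
  ext a b
  simp only [graphOf, inputStore, SimpleGraph.fromRel_adj, Fin.is_lt, Fin.eta, exists_true_left,
    true_and, ne_eq, ite_eq_right_iff, one_ne_zero, imp_false, not_not, G.adj_comm b a, or_self,
    and_iff_right_iff_imp]
  exact fun h => h.ne

theorem Coverable.le_one {n : ℕ} {G : SimpleGraph (Fin n)} {α c : ℝ} {m : ℕ} (h0 : 0 ≤ α)
    (h1 : α ≤ 1) (h : Coverable G α m c) (u : Fin n) : c ≤ 1 := by
  obtain ⟨D, -, h⟩ := h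
  rcases h u u with h | ⟨p, -, h⟩ <;> exact h.trans (proximity_le_one h0 h1 _ _)

/-- A coverable threshold can be raised to the proximity of some pair in a graph with at most one
additional edge. -/
theorem Coverable.exists_eq_proximity {n : ℕ} (hn : 0 < n) {G : SimpleGraph (Fin n)} {α c : ℝ}
    {m : ℕ} (h : Coverable G α m c) : ∃ s t u v : Fin n,
      c ≤ proximity (G ⊔ SimpleGraph.edge s t) α u v ∧
        Coverable G α m (proximity (G ⊔ SimpleGraph.edge s t) α u v) := by
  classical
  obtain ⟨D, hD, h⟩ := h
  have hloop : ∀ u : Fin n, G ⊔ SimpleGraph.edge u u = G := by simp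
  -- These are the thresholds that the program tries and that are at least `c`; `s = t` accounts for
  -- `G` itself. None of them lies strictly between `c` and their minimum, so the cover for `c` also
  -- works for the minimum.
  let S : Finset (Fin n × Fin n × Fin n × Fin n) := Finset.univ.filter fun q =>
    c ≤ proximity (G ⊔ SimpleGraph.edge q.1 q.2.1) α q.2.2.1 q.2.2.2
  have hS : S.Nonempty := by
    rcases h ⟨0, hn⟩ ⟨0, hn⟩ with h' | ⟨p, -, h'⟩
    · exact ⟨(⟨0, hn⟩, ⟨0, hn⟩, ⟨0, hn⟩, ⟨0, hn⟩),
        Finset.mem_filter.2 ⟨Finset.mem_univ _, by rw [hloop]; exact h'⟩⟩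
    · exact ⟨(p.1, p.2, ⟨0, hn⟩, ⟨0, hn⟩), Finset.mem_filter.2 ⟨Finset.mem_univ _, h'⟩⟩
  obtain ⟨q, hq, hmin⟩ := Finset.exists_min_image S
    (fun q => proximity (G ⊔ SimpleGraph.edge q.1 q.2.1) α q.2.2.1 q.2.2.2) hS
  refine ⟨q.1, q.2.1, q.2.2.1, q.2.2.2, (Finset.mem_filter.1 hq).2, D, hD, fun u v => ?_⟩
  rcases h u v with h' | ⟨p, hp, h'⟩
  · refine Or.inl ?_
    have := hmin (u, u, u, v) (Finset.mem_filter.2 ⟨Finset.mem_univ _, by rw [hloop]; exact h'⟩)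
    rwa [hloop] at this
  · exact Or.inr ⟨p, hp, hmin (p.1, p.2, u, v) (Finset.mem_filter.2 ⟨Finset.mem_univ _, h'⟩)⟩

theorem budget_le {n k B : ℕ} (h : n ≤ B) :
    2 * (4 * min k n ^ 2) * Nat.clog 2 n ≤ 8 * (B + 1) ^ 3 := by
  have h1 : Nat.clog 2 n ≤ B + 1 :=
    (Nat.clog_le_of_le_pow Nat.lt_two_pow_self.le).trans (h.trans (Nat.le_succ B))
  have h2 : min k n ≤ B + 1 := (min_le_right k n).trans (h.trans (Nat.le_succ B))
  calc 2 * (4 * min k n ^ 2) * Nat.clog 2 n = 8 * (min k n ^ 2 * Nat.clog 2 n) := by ring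
    _ ≤ 8 * ((B + 1) ^ 2 * (B + 1)) := by gcongr
    _ = 8 * (B + 1) ^ 3 := by ring

/-- The algorithm `greedyBroadcast` runs in polynomial time and attains every coverable
threshold. -/
theorem greedyBroadcast_spec : ∃ T : Polynomial ℕ, ∀ (α ε : ℝ), 0 ≤ α → α ≤ 1 →
    ∀ (n : ℕ) (G : SimpleGraph (Fin n)) (k : ℕ), 0 < n →
      ∃ (t : ℕ) (F : Finset (Sym2 (Fin n))), Outputs greedyBroadcast n G k α ε t F ∧
        t ≤ T.eval (inputSize n k) ∧ IsAugmentation G F ∧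
        F.card ≤ 8 * k ^ 2 * Nat.clog 2 n ∧
        ∀ c : ℝ, Coverable G α (4 * min k n ^ 2) c → c ≤ broadcast (addEdges G F) α := by
  classical
  obtain ⟨T, hT⟩ := greedyBroadcast.exists_polynomial_bound
  -- The cubic polynomial bounds all loop lengths: `n`, `min k n ^ 2` and the number of greedy
  -- steps.
  refine ⟨T.comp (8 * (Polynomial.X + 1) ^ 3), fun α ε hα hα1 n G k hn => ?_⟩
  have hnB : n ≤ inputSize n k := Nat.le_add_right _ _
  have hB1 : inputSize n k + 1 ≤ 8 * (inputSize n k + 1) ^ 3 := by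
    have := Nat.le_self_pow three_ne_zero (inputSize n k + 1)
    omega
  have hB2 : min k n ^ 2 ≤ 8 * (inputSize n k + 1) ^ 3 := by
    have h1 : min k n ^ 2 ≤ (inputSize n k + 1) ^ 2 :=
      Nat.pow_le_pow_left ((min_le_right k n).trans (by omega)) 2
    have h2 : (inputSize n k + 1) ^ 2 ≤ (inputSize n k + 1) ^ 3 :=
      Nat.pow_le_pow_right (by omega) (by omega)
    omega
  have hA : graphOf n ((inputStore n G k α ε).natArr 0) = G := graphOf_inputStore G k α ε
  obtain ⟨t, τ, ht, hr, F, hFc, hout, hgood⟩ := halts_greedyBroadcast (n := n) (k := k)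
    (B := 8 * (inputSize n k + 1) ^ 3) hα hα1 (σ := inputStore n G k α ε)
    rfl rfl (by simp [inputStore]) hA rfl (by omega) hB2 (budget_le hnB)
  -- Greedy steps may pick loops or edges of `G`; discarding them leaves the augmented graph
  -- unchanged.
  have hadd : addEdges G (F.filter (· ∈ Gᶜ.edgeSet)) = addEdges G F := by
    ext a b
    simp only [addEdges, SimpleGraph.sup_adj, SimpleGraph.fromEdgeSet_adj, Finset.coe_filter,
      Set.mem_ofPred_eq, SimpleGraph.mem_edgeSet, SimpleGraph.compl_adj, Finset.mem_coe]
    tauto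
  refine ⟨t, F.filter (· ∈ Gᶜ.edgeSet), ⟨τ, hr, fun i j => ?_⟩, ?_, ?_, ?_, fun c hc => ?_⟩
  · rw [hout i j]
    refine if_congr ?_ rfl rfl
    simp only [addEdges, inputStore, SimpleGraph.sup_adj, SimpleGraph.fromEdgeSet_adj,
      Finset.mem_filter, SimpleGraph.mem_edgeSet, SimpleGraph.compl_adj, Finset.mem_coe,
      Fin.is_lt, Fin.eta, exists_true_left, true_and, ite_eq_right_iff, one_ne_zero, imp_false]
    tauto
  · rw [Polynomial.eval_comp, ← hT]
    simpa using ht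
  · intro e he
    exact (Finset.mem_filter.1 he).2
  · refine (Finset.card_filter_le _ _).trans (hFc.trans ?_)
    calc 2 * (4 * min k n ^ 2) * Nat.clog 2 n = 8 * min k n ^ 2 * Nat.clog 2 n := by ring
      _ ≤ 8 * k ^ 2 * Nat.clog 2 n := by gcongr; exact min_le_left k n
  · rw [hadd]
    have : Nonempty (Fin n × Fin n) := ⟨(⟨0, hn⟩, ⟨0, hn⟩)⟩
    refine le_ciInf fun p => ?_
    by_cases hn2 : 2 ≤ n
    · obtain ⟨s, t', u, v, hle, hcov⟩ := hc.exists_eq_proximity hn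
      obtain ⟨K, hK, hKb⟩ := hgood s t' u v
      refine hle.trans (hKb _ (fun u' v' => ?_) p.1 p.2)
      exact GreedyReach.le_proximity hα hα1 (by simpa using hn2) hcov (by simpa using hK) u' v'
    · have : p.1 = p.2 := by ext; have := p.1.2; have := p.2.2; omega
      rw [this, proximity_self]
      exact hc.le_one hα hα1 p.1

/-- For an uncovered pair, the estimates of `exists_covering_pairs` with `c = β q` would push its
proximity in `G + F` strictly below the broadcast `β`. Each alternative for `q` makes one of the two
estimates contradictory. -/
theorem coverable_broadcast_mul {n k : ℕ} {G : SimpleGraph (Fin n)} {α q : ℝ} (h0 : 0 < α)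
    (h1 : α ≤ 1) {F : Finset (Sym2 (Fin n))} (hF : IsAugmentation G F) (hk : F.card ≤ k)
    (hq0 : 0 ≤ q) (hq : q * (1 + k * ↑(2 * k * (2 * k - 1))) < 1 ∨ q * (1 + 4 * (k : ℝ) ^ 2) < α) :
    Coverable G α (4 * min k n ^ 2) (broadcast (addEdges G F) α * q) := by
  obtain ⟨D, hD1, hD2, hD⟩ := exists_covering_pairs h0.le h1 hF hk
  rw [Fintype.card_fin] at hD2
  refine ⟨D, hD2, fun u v => ?_⟩
  by_contra hcon
  push Not at hcon
  obtain ⟨hG, hDc⟩ := hcon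
  obtain ⟨ha, hb⟩ := hD u v _ hG.le fun p hp => (hDc p hp).le
  set β := broadcast (addEdges G F) α with hβ
  have hβu : β ≤ proximity (addEdges G F) α u v := broadcast_le_proximity h0.le h1 u v
  have hpos : 0 < β * q := (proximity_nonneg h0.le h1 u v).trans_lt hG
  have hβ0 : 0 < β := by
    by_contra hneg
    nlinarith
  rcases hq with hq | hq
  · have h2 : (D.card : ℝ) ≤ ↑(2 * k * (2 * k - 1)) := by exact_mod_cast hD1
    have h3 : (k : ℝ) * D.card ≤ k * ↑(2 * k * (2 * k - 1)) := by gcongr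
    nlinarith [mul_le_mul_of_nonneg_left h3 hpos.le, mul_lt_mul_of_pos_left hq hβ0]
  · have h2 : (D.card : ℝ) ≤ 4 * (k : ℝ) ^ 2 := by
      have : D.card ≤ 4 * k ^ 2 := hD2.trans (by gcongr; exact min_le_left k n)
      exact_mod_cast this
    nlinarith [mul_le_mul_of_nonneg_left h2 hpos.le, mul_lt_mul_of_pos_left hq hβ0,
      mul_le_mul_of_nonneg_left hβu h0.le]

theorem optBroadcast_mul_le {n k : ℕ} {G : SimpleGraph (Fin n)} {α q b : ℝ} (hq : 0 < q)
    (h : ∀ F : Finset (Sym2 (Fin n)), IsAugmentation G F → F.card ≤ k →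
      broadcast (addEdges G F) α * q ≤ b) : optBroadcast G α k * q ≤ b := by
  rw [← le_div_iff₀ hq]
  refine csSup_le ⟨_, ∅, by simp [IsAugmentation], by simp, rfl⟩ ?_
  rintro _ ⟨F, hF, hk, rfl⟩
  rw [le_div_iff₀ hq]
  exact h F hF hk

/-- Rounding up costs less than `1`, which is at most `logb 2 n` once `n ≥ 2`; for `n = 1` both
sides vanish. -/
theorem clog_le_two_mul_logb {n : ℕ} (hn : 0 < n) : (Nat.clog 2 n : ℝ) ≤ 2 * Real.logb 2 n := by
  rcases Nat.lt_or_ge n 2 with h | h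
  · obtain rfl : n = 1 := by omega
    simp
  · have h1 : ((2 ^ (Nat.clog 2 n - 1) : ℕ) : ℝ) < n := by
      exact_mod_cast Nat.pow_pred_clog_lt_self one_lt_two h
    have hn0 : (0 : ℝ) < n := by exact_mod_cast hn
    have h2 : ((Nat.clog 2 n - 1 : ℕ) : ℝ) ≤ Real.logb 2 n := by
      rw [Real.le_logb_iff_rpow_le one_lt_two hn0, Real.rpow_natCast]
      exact_mod_cast h1.le
    have h3 : 1 ≤ Real.logb 2 n := by
      rw [Real.le_logb_iff_rpow_le one_lt_two hn0, Real.rpow_one]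
      exact_mod_cast h
    rw [Nat.cast_sub (Nat.clog_pos one_lt_two h)] at h2
    push_cast at h2
    linarith

end Approximation

theorem mainTheorem4 :
    ∃ C : ℝ, ∀ ε α : ℝ, 0 < ε → 0 < α → α ≤ 1 →
      (∃ (P : OracleMachine.Program) (T : Polynomial ℕ),
        ∀ (n : ℕ) (G : SimpleGraph (Fin n)) (k : ℕ), G.Connected → 1 ≤ k →
          ∃ (t : ℕ) (F : Finset (Sym2 (Fin n))),
            Outputs P n G k α ε t F ∧
            t ≤ T.eval (inputSize n k) ∧
            IsAugmentation G F ∧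
            (F.card : ℝ) ≤ C * (k : ℝ) ^ 3 * Real.logb 2 n ∧
            4 * optBroadcast G α k / ((1 + ε) * (12 * (k : ℝ) ^ 4 + 3 * (k : ℝ) ^ 2)) ≤
              broadcast (addEdges G F) α) ∧
      (∃ (P : OracleMachine.Program) (T : Polynomial ℕ),
        ∀ (n : ℕ) (G : SimpleGraph (Fin n)) (k : ℕ), G.Connected →
          ∃ (t : ℕ) (F : Finset (Sym2 (Fin n))),
            Outputs P n G k α ε t F ∧
            t ≤ T.eval (inputSize n k) ∧
            IsAugmentation G F ∧
            (F.card : ℝ) ≤ C * (k : ℝ) ^ 2 * Real.logb 2 n ∧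
            optBroadcast G α k * α / ((1 + ε) * (12 * (k : ℝ) ^ 2 + 3)) ≤
              broadcast (addEdges G F) α) := by
  obtain ⟨T, hT⟩ := greedyBroadcast_spec
  -- The constant is the `8` of the greedy budget times the `2` lost in replacing `Nat.clog` by
  -- `logb`.
  refine ⟨16, fun ε α hε hα hα1 => ⟨⟨OracleMachine.greedyBroadcast, T, fun n G k hG hk => ?_⟩,
    ⟨OracleMachine.greedyBroadcast, T, fun n G k hG => ?_⟩⟩⟩
  · have hn : 0 < n := Fin.pos_iff_nonempty.2 hG.nonempty
    obtain ⟨t, F, hout, ht, hF, hFc, hcov⟩ := hT α ε hα.le hα1 n G k hn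
    have hk1 : (1 : ℝ) ≤ k := by exact_mod_cast hk
    have hlog := clog_le_two_mul_logb hn
    have hFc' : (F.card : ℝ) ≤ 8 * (k : ℝ) ^ 2 * Nat.clog 2 n := by exact_mod_cast hFc
    refine ⟨t, F, hout, ht, hF, ?_, ?_⟩
    · calc (F.card : ℝ) ≤ 8 * (k : ℝ) ^ 2 * Nat.clog 2 n := hFc'
        _ ≤ 8 * (k : ℝ) ^ 3 * (2 * Real.logb 2 n) := by gcongr; norm_num
        _ = 16 * (k : ℝ) ^ 3 * Real.logb 2 n := by ring
    · have hden : 0 < (1 + ε) * (12 * (k : ℝ) ^ 4 + 3 * (k : ℝ) ^ 2) := by positivity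
      rw [mul_comm 4, mul_div_assoc]
      refine optBroadcast_mul_le (by positivity) fun F' hF' hk' =>
        hcov _ (coverable_broadcast_mul hα hα1 hF' hk' (by positivity) (Or.inl ?_))
      rw [div_mul_eq_mul_div, div_lt_one hden, Nat.cast_mul, Nat.cast_sub (by omega)]
      push_cast
      -- At `k = 1` this reads `12 < 15`. The cruder count `4k²` of pairs would give `20` on the
      -- left and fail.
      have h1 : 4 * (1 + (k : ℝ) * (2 * k * (2 * k - 1))) < 12 * (k : ℝ) ^ 4 + 3 * (k : ℝ) ^ 2 := by
        have h2 : (1 : ℝ) ≤ (k : ℝ) ^ 2 := one_le_pow₀ hk1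
        nlinarith [mul_nonneg (sub_nonneg.2 h2) (sq_nonneg ((k : ℝ) - 1)),
          mul_nonneg (sq_nonneg (k : ℝ)) (sq_nonneg (3 * (k : ℝ) - 2))]
      have h3 : 0 ≤ ε * (12 * (k : ℝ) ^ 4 + 3 * (k : ℝ) ^ 2) := by positivity
      linarith
  · have hn : 0 < n := Fin.pos_iff_nonempty.2 hG.nonempty
    obtain ⟨t, F, hout, ht, hF, hFc, hcov⟩ := hT α ε hα.le hα1 n G k hn
    have hlog := clog_le_two_mul_logb hn
    have hFc' : (F.card : ℝ) ≤ 8 * (k : ℝ) ^ 2 * Nat.clog 2 n := by exact_mod_cast hFc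
    refine ⟨t, F, hout, ht, hF, ?_, ?_⟩
    · calc (F.card : ℝ) ≤ 8 * (k : ℝ) ^ 2 * Nat.clog 2 n := hFc'
        _ ≤ 8 * (k : ℝ) ^ 2 * (2 * Real.logb 2 n) := by gcongr
        _ = 16 * (k : ℝ) ^ 2 * Real.logb 2 n := by ring
    · have hden : 0 < (1 + ε) * (12 * (k : ℝ) ^ 2 + 3) := by positivity
      rw [mul_div_assoc]
      refine optBroadcast_mul_le (by positivity) fun F' hF' hk' =>
        hcov _ (coverable_broadcast_mul hα hα1 hF' hk' (by positivity) (Or.inr ?_))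
      rw [div_mul_eq_mul_div, div_lt_iff₀ hden]
      refine mul_lt_mul_of_pos_left ?_ hα
      -- There is room to spare, as `12k² + 3 = 3 (1 + 4k²)`.
      nlinarith [sq_nonneg (k : ℝ), mul_nonneg hε.le (sq_nonneg (k : ℝ))]
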